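/- Let $E$ be an elliptic curve over $\mathbb{R}$, and give $E(\mathbb{C})$ its usual (analytic) topology. Let $E(\mathbb{C})^-$ denote the subgroup of points $P \in E(\mathbb{C})$ whose complex conjugate is $-P$, let $E(\mathbb{C})^-_0$ be the connected component of the identity in $E(\mathbb{C})^-$, and let $H_1(E(\mathbb{C}),\mathbb{Z})^-$ be the subgroup of those classes in the first singular homology group $H_1(E(\mathbb{C}),\mathbb{Z})$ that are negated by the action of complex conjugation. Then the homomorphism $H_1(E(\mathbb{C})^-_0,\mathbb{Z}) \to H_1(E(\mathbb{C}),\mathbb{Z})$ induced by the inclusion $E(\mathbb{C})^-_0 \subseteq E(\mathbb{C})$ takes values in $H_1(E(\mathbb{C}),\mathbb{Z})^-$, and the resulting natural map $$H_1(E(\mathbb{C})^-_0,\mathbb{Z}) \longrightarrow H_1(E(\mathbb{C}),\mathbb{Z})^-$$ is an isomorphism. -/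

import Mathlib

open scoped LinearAlgebra.Projectivization

/-! ### The complex points of an elliptic curve over the reals, with their analytic topology -/

/-- The group `E(ℂ)` of complex points of a Weierstrass curve `E` over `ℝ`:
the affine solutions of the equation together with the point at infinity `0 = [0 : 1 : 0]`. -/
noncomputable abbrev ComplexPoints (E : WeierstrassCurve ℝ) : Type :=
  (E.baseChange ℂ).toAffine.Point

/-- The usual topology on the complex projective plane `ℙ²(ℂ)`, as the quotient of `ℂ³ ∖ {0}`. -/
noncomputable instance projectivePlaneTopology : TopologicalSpace (ℙ ℂ (Fin 3 → ℂ)) :=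
  TopologicalSpace.coinduced (Projectivization.mk' ℂ) inferInstance

/-- The embedding of `E(ℂ)` in `ℙ²(ℂ)`, given by `(x, y) ↦ [x : y : 1]` and `0 ↦ [0 : 1 : 0]`. -/
noncomputable def toProjectivePlane (E : WeierstrassCurve ℝ) :
    ComplexPoints E → ℙ ℂ (Fin 3 → ℂ)
  | .zero => Projectivization.mk ℂ ![0, 1, 0] (fun h => one_ne_zero (congrFun h 1))
  | .some x y _ => Projectivization.mk ℂ ![x, y, 1] (fun h => one_ne_zero (congrFun h 2))

/-- The analytic topology on `E(ℂ)`: the subspace topology from `ℙ²(ℂ)`. -/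
noncomputable instance complexPointsTopology (E : WeierstrassCurve ℝ) : TopologicalSpace (ComplexPoints E) :=
  TopologicalSpace.induced (toProjectivePlane E) inferInstance

/-! ### Complex conjugation -/

/-- Complex conjugation on `E(ℂ)`, the group homomorphism `(x, y) ↦ (x̄, ȳ)`. -/
noncomputable def complexConj (E : WeierstrassCurve ℝ) : ComplexPoints E →+ ComplexPoints E :=
  WeierstrassCurve.Affine.Point.map (W' := E) (Complex.conjAe : ℂ →ₐ[ℝ] ℂ)

/-- Complex conjugation of the coordinates on `ℙ²(ℂ)`; only used to prove that
complex conjugation on `E(ℂ)` is continuous. -/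
noncomputable def projectiveConj : ℙ ℂ (Fin 3 → ℂ) → ℙ ℂ (Fin 3 → ℂ) :=
  Projectivization.lift
    (fun v => Projectivization.mk ℂ (star v.1) (star_ne_zero.mpr v.2))
    (fun a b t h => by
      refine (Projectivization.mk_eq_mk_iff' ℂ _ _ _ _).mpr ⟨star t, ?_⟩
      rw [h, star_smul])

theorem continuous_projectiveConj : Continuous projectiveConj := by
  refine continuous_coinduced_dom.mpr ?_
  have h : Continuous (fun v : {v : Fin 3 → ℂ // v ≠ 0} =>
      (⟨star v.1, star_ne_zero.mpr v.2⟩ : {v : Fin 3 → ℂ // v ≠ 0})) :=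
    (continuous_star.comp continuous_subtype_val).subtype_mk _
  have hq : Continuous (Projectivization.mk' ℂ : {v : Fin 3 → ℂ // v ≠ 0} → _) :=
    continuous_coinduced_rng
  exact hq.comp h

theorem toProjectivePlane_complexConj (E : WeierstrassCurve ℝ) (P : ComplexPoints E) :
    toProjectivePlane E (complexConj E P) = projectiveConj (toProjectivePlane E P) := by
  have h : ∀ (a b c : ℂ), star ![a, b, c] = ![star a, star b, star c] := by
    intro a b c
    funext i
    fin_cases i <;> rfl
  rcases P with _ | ⟨x, y, hxy⟩
  · change Projectivization.mk ℂ ![0, 1, 0] _ = Projectivization.mk ℂ (star ![0, 1, 0]) _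
    congr 1
    rw [h, star_zero, star_one]
  · change Projectivization.mk ℂ ![star x, star y, 1] _ = Projectivization.mk ℂ (star ![x, y, 1]) _
    congr 1
    rw [h, star_one]

theorem continuous_complexConj (E : WeierstrassCurve ℝ) : Continuous (complexConj E) := by
  refine continuous_induced_rng.mpr ?_
  have h : toProjectivePlane E ∘ complexConj E = projectiveConj ∘ toProjectivePlane E :=
    funext (toProjectivePlane_complexConj E)
  rw [h]
  exact continuous_projectiveConj.comp continuous_induced_dom

/-- The subgroup `E(ℂ)⁻` of points `P` of `E(ℂ)` whose complex conjugate is `-P`. -/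
noncomputable def antiInvariantPoints (E : WeierstrassCurve ℝ) : AddSubgroup (ComplexPoints E) where
  carrier := {P | complexConj E P = -P}
  zero_mem' := by simp
  add_mem' := by
    intro P Q hP hQ
    simp only [Set.mem_ofPred_eq] at hP hQ ⊢
    rw [map_add, hP, hQ, neg_add]
  neg_mem' := by
    intro P hP
    simp only [Set.mem_ofPred_eq] at hP ⊢
    rw [map_neg, hP]

/-- The connected component `E(ℂ)⁻₀` of the identity in `E(ℂ)⁻`, with the subspace topology. -/
noncomputable abbrev AntiInvariantComponent (E : WeierstrassCurve ℝ) : Type :=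
  connectedComponent (0 : antiInvariantPoints E)

/-! ### First integral singular homology -/

/-- The first singular homology group `H₁(X, ℤ)`. -/
noncomputable abbrev H1 (X : Type) [TopologicalSpace X] : ModuleCat.{0} ℤ :=
  ((AlgebraicTopology.singularHomologyFunctor (ModuleCat.{0} ℤ) 1).obj (ModuleCat.of ℤ ℤ)).obj
    (TopCat.of X)

/-- The group homomorphism `f_* : H₁(X, ℤ) → H₁(Y, ℤ)` induced by a continuous map `f : X → Y`. -/
noncomputable def H1map {X Y : Type} [TopologicalSpace X] [TopologicalSpace Y] (f : C(X, Y)) :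
    H1 X →+ H1 Y :=
  (((AlgebraicTopology.singularHomologyFunctor (ModuleCat.{0} ℤ) 1).obj (ModuleCat.of ℤ ℤ)).map
    (TopCat.ofHom f)).hom.toAddMonoidHom

/-- The subgroup `H₁(E(ℂ), ℤ)⁻` of homology classes that are negated by complex conjugation. -/
noncomputable def H1minus (E : WeierstrassCurve ℝ) : AddSubgroup (H1 (ComplexPoints E)) where
  carrier := {c | H1map ⟨complexConj E, continuous_complexConj E⟩ c = -c}
  zero_mem' := by simp
  add_mem' := by
    intro a b ha hb
    simp only [Set.mem_ofPred_eq] at ha hb ⊢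
    rw [map_add, ha, hb, neg_add]
  neg_mem' := by
    intro a ha
    simp only [Set.mem_ofPred_eq] at ha ⊢
    rw [map_neg, ha]

/-- The inclusion `E(ℂ)⁻₀ ⊆ E(ℂ)` as a continuous map. -/
noncomputable def antiInvariantComponentInclusion (E : WeierstrassCurve ℝ) :
    C(AntiInvariantComponent E, ComplexPoints E) :=
  ⟨fun P => P.1.1, continuous_subtype_val.comp continuous_subtype_val⟩

/-!
Integrating the invariant differential `dx / ψ` gives a logarithm near `0 ∈ E(ℂ)`, because
translations preserve the differential. Its local inverse extends to a homomorphism `p : ℂ → E(ℂ)`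
that is open with discrete kernel `Λ`; it is surjective because an open nontrivial subgroup of
`E(ℂ)` is everything. Hence `p` is a covering, and `Λ ≃ H₁(E(ℂ), ℤ)`, where `λ` corresponds to the
class of the image of the segment `[0, λ]`.

Complex conjugation lifts to a real linear map `T` of `ℂ` that acts on `Λ` as conjugation acts on
homology, so `H₁(E(ℂ), ℤ)⁻` corresponds to `Λ ∩ ker (T + 1)`. On the other hand `p` maps
`ker (T + 1)` onto `E(ℂ)⁻₀`, and this is again a covering by a vector space, with kernel
`Λ ∩ ker (T + 1)`. Since the periods are compatible with the inclusion, both sides are the same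
subgroup of `Λ`.
-/

/-! ### Homology of spaces covered by a vector space -/

section HomologyModule

open CategoryTheory

variable {R : Type*} [Ring R] {ι : Type*} {c : ComplexShape ι}

theorem exists_homologyι_eq (K : HomologicalComplex (ModuleCat R) c) {i j : ι}
    (hij : c.next i = j) {x : K.opcycles i} (hx : (K.fromOpcycles i j).hom x = 0) :
    ∃ y : K.homology i, (K.homologyι i).hom y = x :=
  (ShortComplex.moduleCat_exact_iff _).mp
    (ShortComplex.exact_of_f_is_kernel
      (ShortComplex.mk _ _ (K.homologyι_comp_fromOpcycles i j)) (K.homologyIsKernel i j hij)) x hx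

theorem homologyι_injective (K : HomologicalComplex (ModuleCat R) c) (i : ι) :
    Function.Injective (K.homologyι i).hom :=
  (ModuleCat.mono_iff_injective (K.homologyι i)).mp inferInstance

theorem pOpcycles_surjective (K : HomologicalComplex (ModuleCat R) c) (i : ι) :
    Function.Surjective (K.pOpcycles i).hom :=
  (ModuleCat.epi_iff_surjective (K.pOpcycles i)).mp inferInstance

theorem fromOpcycles_pOpcycles_apply (K : HomologicalComplex (ModuleCat R) c) (i j : ι)
    (x : K.X i) : (K.fromOpcycles i j).hom ((K.pOpcycles i).hom x) = (K.d i j).hom x :=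
  congrArg (fun f => f.hom x) (K.p_fromOpcycles i j)

theorem opcyclesMap_pOpcycles_apply {K L : HomologicalComplex (ModuleCat R) c} (f : K ⟶ L) (i : ι)
    (x : K.X i) : (HomologicalComplex.opcyclesMap f i).hom ((K.pOpcycles i).hom x) =
      (L.pOpcycles i).hom ((f.f i).hom x) :=
  congrArg (fun g => g.hom x) (HomologicalComplex.p_opcyclesMap f i)

theorem homologyι_homologyMap_apply {K L : HomologicalComplex (ModuleCat R) c} (f : K ⟶ L) (i : ι)
    (x : K.homology i) : (L.homologyι i).hom ((HomologicalComplex.homologyMap f i).hom x) =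
      (HomologicalComplex.opcyclesMap f i).hom ((K.homologyι i).hom x) :=
  congrArg (fun g => g.hom x) (HomologicalComplex.homologyι_naturality f i)

theorem pOpcycles_eq_zero_of_subsingleton_homology (K : HomologicalComplex (ModuleCat R) c)
    {i j : ι} (hij : c.next i = j) (hK : Subsingleton (K.homology i)) {x : K.X i}
    (hx : (K.d i j).hom x = 0) : (K.pOpcycles i).hom x = 0 := by
  obtain ⟨y, hy⟩ :=
    exists_homologyι_eq K hij ((fromOpcycles_pOpcycles_apply K i j x).trans hx)
  rw [← hy, Subsingleton.elim y 0, map_zero]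

end HomologyModule

namespace SingularChain

open CategoryTheory Limits AlgebraicTopology Simplicial

variable {X Y : Type} [TopologicalSpace X] [TopologicalSpace Y]

/-- The singular chain complex of `X` with integral coefficients, whose first homology is `H1 X`. -/
noncomputable abbrev complex (X : Type) [TopologicalSpace X] : ChainComplex (ModuleCat.{0} ℤ) ℕ :=
  ((singularChainComplexFunctor (ModuleCat.{0} ℤ)).obj (ModuleCat.of ℤ ℤ)).obj (TopCat.of X)

/-- The chain map induced by a continuous map. -/
noncomputable abbrev map (f : C(X, Y)) : complex X ⟶ complex Y :=
  ((singularChainComplexFunctor (ModuleCat.{0} ℤ)).obj (ModuleCat.of ℤ ℤ)).map (TopCat.ofHom f)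

/-- A continuous map on the standard simplex, as a simplex of the singular simplicial set. -/
noncomputable def toSimplex {n : ℕ} (σ : C(stdSimplex ℝ (Fin (n + 1)), X)) :
    (TopCat.toSSet.obj (TopCat.of X)) _⦋n⦌ :=
  (TopCat.toSSetObjEquiv (TopCat.of X) (.op ⦋n⦌)).symm σ

/-- The singular chain consisting of one simplex with coefficient `1`. -/
noncomputable def single {n : ℕ} (σ : C(stdSimplex ℝ (Fin (n + 1)), X)) : (complex X).X n :=
  (SSet.ιChainComplex (R := ModuleCat.of ℤ ℤ) (TopCat.toSSet.obj (TopCat.of X)) (toSimplex σ)).hom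
    (1 : ℤ)

/-- The inclusion of the face of the standard simplex opposite to the vertex `i`. -/
noncomputable def face {n : ℕ} (i : Fin (n + 2)) :
    C(stdSimplex ℝ (Fin (n + 1)), stdSimplex ℝ (Fin (n + 2))) :=
  ⟨stdSimplex.map i.succAbove, stdSimplex.continuous_map _⟩

theorem face_vertex {n : ℕ} (i : Fin (n + 2)) (j : Fin (n + 1)) :
    face i (stdSimplex.vertex j) = stdSimplex.vertex (i.succAbove j) :=
  stdSimplex.map_vertex _ _

theorem d_single {n : ℕ} (σ : C(stdSimplex ℝ (Fin (n + 2)), X)) :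
    ((complex X).d (n + 1) n).hom (single σ) =
      ∑ i : Fin (n + 2), (-1 : ℤ) ^ (i : ℕ) • single (σ.comp (face i)) := by
  have h := congrArg (fun f => f.hom (1 : ℤ))
    (SSet.ιChainComplex_d (TopCat.toSSet.obj (TopCat.of X)) (ModuleCat.of ℤ ℤ) (toSimplex σ))
  simp only [ModuleCat.hom_sum, ModuleCat.hom_smul, LinearMap.coe_sum, LinearMap.coe_smul,
    Finset.sum_apply, Pi.smul_apply] at h
  exact h

theorem map_single {n : ℕ} (f : C(X, Y)) (σ : C(stdSimplex ℝ (Fin (n + 1)), X)) :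
    ((map f).f n).hom (single σ) = single (f.comp σ) :=
  congrArg (fun g => g.hom (1 : ℤ)) (SSet.ι_chainComplexMap_f
    (X := TopCat.toSSet.obj (TopCat.of X)) (Y := TopCat.toSSet.obj (TopCat.of Y))
    (TopCat.toSSet.map (TopCat.ofHom f)) (ModuleCat.of ℤ ℤ) (toSimplex σ))

theorem hom_ext {n : ℕ} {M : ModuleCat.{0} ℤ} {φ ψ : (complex X).X n ⟶ M}
    (h : ∀ σ : C(stdSimplex ℝ (Fin (n + 1)), X), φ.hom (single σ) = ψ.hom (single σ)) : φ = ψ := by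
  refine SSet.chainComplex_hom_ext fun x => ?_
  obtain ⟨σ, rfl⟩ := (TopCat.toSSetObjEquiv (TopCat.of X) (.op ⦋n⦌)).symm.surjective x
  exact ModuleCat.hom_ext (LinearMap.ext_ring (h σ))

/-- The homomorphism on singular chains with prescribed values on simplices. -/
noncomputable def desc {n : ℕ} {M : ModuleCat.{0} ℤ}
    (φ : C(stdSimplex ℝ (Fin (n + 1)), X) → M) : (complex X).X n ⟶ M :=
  Sigma.desc (f := fun _ : (TopCat.toSSet.obj (TopCat.of X)) _⦋n⦌ => ModuleCat.of ℤ ℤ)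
    fun x => ModuleCat.ofHom
      (LinearMap.toSpanSingleton ℤ M (φ (TopCat.toSSetObjEquiv (TopCat.of X) (.op ⦋n⦌) x)))

theorem desc_single {n : ℕ} {M : ModuleCat.{0} ℤ}
    (φ : C(stdSimplex ℝ (Fin (n + 1)), X) → M) (σ : C(stdSimplex ℝ (Fin (n + 1)), X)) :
    (desc φ).hom (single σ) = φ σ := by
  have h := congrArg (fun f => f.hom (1 : ℤ)) (Sigma.ι_desc (C := ModuleCat.{0} ℤ)
    (f := fun _ : (TopCat.toSSet.obj (TopCat.of X)) _⦋n⦌ => ModuleCat.of ℤ ℤ)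
    (fun x => ModuleCat.ofHom (LinearMap.toSpanSingleton ℤ M
      (φ (TopCat.toSSetObjEquiv (TopCat.of X) (.op ⦋n⦌) x)))) (toSimplex σ))
  rw [toSimplex, Equiv.apply_symm_apply] at h
  exact h.trans (LinearMap.toSpanSingleton_apply_one ℤ (M := M) (φ σ))

theorem d_single_one (σ : C(stdSimplex ℝ (Fin 2), X)) :
    ((complex X).d 1 0).hom (single σ) =
      single (n := 0) (.const _ (σ (stdSimplex.vertex 1))) -
        single (n := 0) (.const _ (σ (stdSimplex.vertex 0))) := by
  have hface (i : Fin 2) (j : Fin 2) (hij : i.succAbove 0 = j) :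
      σ.comp (face (n := 0) i) = .const _ (σ (stdSimplex.vertex j)) := by
    ext t
    rw [Subsingleton.elim t (stdSimplex.vertex 0), ContinuousMap.comp_apply, face_vertex, hij,
      ContinuousMap.const_apply]
  rw [d_single, Fin.sum_univ_two, hface 0 1 rfl, hface 1 0 rfl, Fin.val_zero, Fin.val_one,
    pow_zero, pow_one, one_zsmul, neg_one_zsmul, sub_eq_add_neg]

theorem d_single_two (σ : C(stdSimplex ℝ (Fin 3), X)) :
    ((complex X).d 2 1).hom (single σ) =
      single (n := 1) (σ.comp (face 0)) - single (n := 1) (σ.comp (face 1)) +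
        single (n := 1) (σ.comp (face 2)) := by
  rw [d_single, Fin.sum_univ_three, Fin.val_zero, Fin.val_one, Fin.val_two, pow_zero, pow_one,
    neg_one_sq, one_zsmul, one_zsmul, neg_one_zsmul, sub_eq_add_neg]

end SingularChain

section H1map

open CategoryTheory AlgebraicTopology

variable {X Y Z : Type} [TopologicalSpace X] [TopologicalSpace Y] [TopologicalSpace Z]

theorem H1map_id (c : H1 X) : H1map (ContinuousMap.id X) c = c :=
  congrArg (fun f => f.hom c)
    (((singularHomologyFunctor (ModuleCat.{0} ℤ) 1).obj (ModuleCat.of ℤ ℤ)).map_id (TopCat.of X))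

theorem H1map_comp (g : C(Y, Z)) (f : C(X, Y)) (c : H1 X) :
    H1map (g.comp f) c = H1map g (H1map f c) :=
  congrArg (fun f => f.hom c)
    (((singularHomologyFunctor (ModuleCat.{0} ℤ) 1).obj (ModuleCat.of ℤ ℤ)).map_comp
      (TopCat.ofHom f) (TopCat.ofHom g))

theorem H1map_eq_of_homotopy {f g : C(X, Y)} (h : f.Homotopy g) : H1map f = H1map g :=
  congrArg (fun f => f.hom.toAddMonoidHom) <|
    TopCat.Homotopy.congr_homologyMap_singularChainComplexFunctor (f := TopCat.ofHom f)
      (g := TopCat.ofHom g) h (ModuleCat.of ℤ ℤ) 1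

theorem subsingleton_H1_of_totallyDisconnectedSpace [TotallyDisconnectedSpace X] :
    Subsingleton (H1 X) :=
  ModuleCat.subsingleton_of_isZero
    (isZero_singularHomologyFunctor_of_totallyDisconnectedSpace _ 1 _ (TopCat.of X) one_ne_zero)

theorem subsingleton_H1_of_contractibleSpace [ContractibleSpace X] : Subsingleton (H1 X) := by
  obtain ⟨x, ⟨h⟩⟩ := id_nullhomotopic X
  have : Subsingleton (H1 Unit) := subsingleton_H1_of_totallyDisconnectedSpace
  let toPoint : C(X, Unit) := .const X ()
  refine subsingleton_of_forall_eq 0 fun c => ?_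
  calc c = H1map (.const X x) c := by rw [← H1map_eq_of_homotopy h, H1map_id]
    _ = H1map (.const Unit x) (H1map toPoint c) := H1map_comp (.const Unit x) toPoint c
    _ = 0 := by rw [Subsingleton.elim (H1map toPoint c) 0, map_zero]

end H1map

section Lifting

variable {T E X : Type*} [TopologicalSpace T] [TopologicalSpace E] [TopologicalSpace X]

theorem exists_comp_eq_of_isCoveringMap [SimplyConnectedSpace T] [LocallyPathConnectedSpace T]
    {p : C(E, X)} (hp : IsCoveringMap p) (hsurj : Function.Surjective p) (σ : C(T, X)) :
    ∃ F : C(T, E), p.comp F = σ := by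
  obtain ⟨t⟩ : Nonempty T := inferInstance
  obtain ⟨e, he⟩ := hsurj (σ t)
  obtain ⟨F, ⟨-, hF⟩, -⟩ := hp.existsUnique_continuousMap_lifts σ t e he
  exact ⟨F, ContinuousMap.ext (congrFun hF)⟩

instance {n : ℕ} : ContractibleSpace (stdSimplex ℝ (Fin (n + 1))) :=
  (convex_stdSimplex ℝ _).contractibleSpace ⟨_, single_mem_stdSimplex ℝ 0⟩

instance {n : ℕ} : LocallyPathConnectedSpace (stdSimplex ℝ (Fin n)) :=
  (convex_stdSimplex ℝ _).locallyPathConnectedSpace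

end Lifting

theorem lift_sub_lift_eq {V A : Type*} [AddCommGroup V] [TopologicalSpace V]
    [IsTopologicalAddGroup V] [AddGroup A] [TopologicalSpace A] {p : V →ₜ+ A}
    (hp : IsCoveringMap p) {T : Type*} [TopologicalSpace T] [PreconnectedSpace T] {F G : C(T, V)}
    (h : p.toContinuousMap.comp F = p.toContinuousMap.comp G) (s t : T) :
    F s - F t = G s - G t := by
  have h' (r : T) : p (F r) = p (G r) := DFunLike.congr_fun h r
  have hlift : p ∘ F = p ∘ fun r => F t - G t + G r := funext fun r => by
    simp only [Function.comp_apply, map_add, map_sub, h', sub_self, zero_add]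
  have hF := congrFun (hp.eq_of_comp_eq F.continuous (by fun_prop) hlift t (by simp)) s
  rw [hF]
  abel

namespace VectorCovering

open CategoryTheory SingularChain

section Segment

variable {V : Type*} [AddCommGroup V] [TopologicalSpace V] [Module ℝ V] [ContinuousSMul ℝ V]

/-- The straight path from `0` to `v`, parametrized by the standard simplex. -/
noncomputable def segment (v : V) : C(stdSimplex ℝ (Fin 2), V) where
  toFun t := t 1 • v
  continuous_toFun := ((continuous_apply 1).comp continuous_subtype_val).smul continuous_const

theorem segment_vertex_zero (v : V) : segment v (stdSimplex.vertex 0) = 0 := by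
  simp [segment]

theorem segment_vertex_one (v : V) : segment v (stdSimplex.vertex 1) = v := by
  simp [segment]

end Segment

variable {V A : Type} [AddCommGroup V] [TopologicalSpace V] [IsTopologicalAddGroup V]
  [AddGroup A] [TopologicalSpace A] {p : V →ₜ+ A}

section SegmentClass

variable [Module ℝ V] [ContinuousSMul ℝ V]

variable (p) in
/-- The image in `A` of the straight path from `0` to `v`, as a chain modulo boundaries. -/
noncomputable def segmentClass (v : V) : (complex A).opcycles 1 :=
  ((complex A).pOpcycles 1).hom (single (p.toContinuousMap.comp (segment v)))

theorem pOpcycles_single_comp (F : C(stdSimplex ℝ (Fin 2), V)) :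
    ((complex A).pOpcycles 1).hom (single (p.toContinuousMap.comp F)) =
      segmentClass p (F (stdSimplex.vertex 1)) - segmentClass p (F (stdSimplex.vertex 0)) := by
  set v₀ := F (stdSimplex.vertex 0)
  set v₁ := F (stdSimplex.vertex 1)
  let z : (complex V).X 1 := single F - (single (segment v₁) - single (segment v₀))
  have hz : ((complex V).d 1 0).hom z = 0 := by
    simp only [z, map_sub, d_single_one, segment_vertex_zero, segment_vertex_one]
    simp only [v₀, v₁, sub_sub_sub_cancel_right, sub_self]
  have hpz : ((complex V).pOpcycles 1).hom z = 0 :=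
    pOpcycles_eq_zero_of_subsingleton_homology _ (by simp) subsingleton_H1_of_contractibleSpace hz
  have hmap := opcyclesMap_pOpcycles_apply (map p.toContinuousMap) 1 z
  rw [hpz, map_zero] at hmap
  simpa only [segmentClass, z, map_sub, map_single, eq_comm (a := (0 : (complex A).opcycles 1)),
    sub_eq_zero] using hmap

theorem segmentClass_add_of_map_eq_zero {l : V} (hl : p l = 0) (v : V) :
    segmentClass p (l + v) = segmentClass p l + segmentClass p v := by
  have hlift : p.toContinuousMap.comp (.const _ l + segment v) =
      p.toContinuousMap.comp (segment v) := ContinuousMap.ext fun t => by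
    change p (l + segment v t) = p (segment v t)
    rw [map_add, hl, zero_add]
  have h := pOpcycles_single_comp (p := p) (.const _ l + segment v)
  rw [hlift] at h
  simp only [ContinuousMap.add_apply, ContinuousMap.const_apply, segment_vertex_zero,
    segment_vertex_one, add_zero] at h
  rw [add_comm (segmentClass p l), ← sub_eq_iff_eq_add]
  exact h.symm

omit [IsTopologicalAddGroup V] in
theorem fromOpcycles_segmentClass {l : V} (hl : p l = 0) :
    ((complex A).fromOpcycles 1 0).hom (segmentClass p l) = 0 := by
  rw [segmentClass, fromOpcycles_pOpcycles_apply, d_single_one]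
  simp only [ContinuousMap.comp_apply, segment_vertex_zero, segment_vertex_one]
  change single (.const _ (p l)) - single (.const _ (p 0)) = 0
  rw [hl, map_zero, sub_self]

end SegmentClass

section Displacement

/-- The difference of the end points of any lift of the path `σ` to `V`. -/
noncomputable def displacement (hp : IsCoveringMap p) (hsurj : Function.Surjective p)
    (σ : C(stdSimplex ℝ (Fin 2), A)) : V :=
  let F := (exists_comp_eq_of_isCoveringMap (p := p.toContinuousMap) hp hsurj σ).choose
  F (stdSimplex.vertex 1) - F (stdSimplex.vertex 0)

variable (hp : IsCoveringMap p) (hsurj : Function.Surjective p)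

theorem displacement_comp (F : C(stdSimplex ℝ (Fin 2), V)) :
    displacement hp hsurj (p.toContinuousMap.comp F) =
      F (stdSimplex.vertex 1) - F (stdSimplex.vertex 0) :=
  lift_sub_lift_eq hp
    (exists_comp_eq_of_isCoveringMap (p := p.toContinuousMap) hp hsurj _).choose_spec _ _

theorem d_comp_desc_displacement :
    (complex A).d 2 1 ≫ desc (M := ModuleCat.of ℤ V) (displacement hp hsurj) = 0 := by
  refine hom_ext fun σ => ?_
  obtain ⟨F, rfl⟩ := exists_comp_eq_of_isCoveringMap (p := p.toContinuousMap) hp hsurj σ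
  change (desc (M := ModuleCat.of ℤ V) (displacement hp hsurj)).hom
    (((complex A).d 2 1).hom (single (p.toContinuousMap.comp F))) = 0
  have hface (i : Fin 3) :
      displacement hp hsurj ((p.toContinuousMap.comp F).comp (face i)) =
        F (stdSimplex.vertex (i.succAbove 1)) - F (stdSimplex.vertex (i.succAbove 0)) := by
    rw [ContinuousMap.comp_assoc, displacement_comp, ContinuousMap.comp_apply,
      ContinuousMap.comp_apply, face_vertex, face_vertex]
  rw [d_single_two, map_add, map_sub, desc_single, desc_single, desc_single, hface, hface, hface]
  change F (stdSimplex.vertex 2) - F (stdSimplex.vertex 1) -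
    (F (stdSimplex.vertex 2) - F (stdSimplex.vertex 0)) +
    (F (stdSimplex.vertex 1) - F (stdSimplex.vertex 0)) = 0
  abel

/-- The displacement of a chain modulo boundaries. -/
noncomputable def opcyclesDisplacement : (complex A).opcycles 1 ⟶ ModuleCat.of ℤ V :=
  (complex A).descOpcycles (desc (displacement hp hsurj)) 2 (by simp)
    (d_comp_desc_displacement hp hsurj)

theorem opcyclesDisplacement_pOpcycles (c : (complex A).X 1) :
    (opcyclesDisplacement hp hsurj).hom (((complex A).pOpcycles 1).hom c) =
      (desc (M := ModuleCat.of ℤ V) (displacement hp hsurj)).hom c :=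
  congrArg (fun f => f.hom c) ((complex A).p_descOpcycles _ 2 _ (d_comp_desc_displacement hp hsurj))

/-- The period of a homology class: the displacement of any cycle representing it. -/
noncomputable def period : H1 A →+ V :=
  ((complex A).homologyι 1 ≫ opcyclesDisplacement hp hsurj).hom.toAddMonoidHom

theorem period_apply (c : H1 A) : period hp hsurj c =
    (opcyclesDisplacement hp hsurj).hom (((complex A).homologyι 1).hom c) :=
  rfl

variable [Module ℝ V] [ContinuousSMul ℝ V]

theorem opcyclesDisplacement_segmentClass (v : V) :
    (opcyclesDisplacement hp hsurj).hom (segmentClass p v) = v := by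
  rw [segmentClass, opcyclesDisplacement_pOpcycles, desc_single, displacement_comp,
    segment_vertex_one, segment_vertex_zero, sub_zero]

end Displacement

section Period

variable [Module ℝ V] [ContinuousSMul ℝ V]

variable (p) in
/-- `segmentClass` on the kernel of `p`, where the segments become loops. -/
noncomputable def loopClass :
    ModuleCat.of ℤ p.toAddMonoidHom.ker ⟶ (complex A).opcycles 1 :=
  let f : p.toAddMonoidHom.ker →+ (complex A).opcycles 1 :=
    .mk' (fun l => segmentClass p l.1) fun l l' => segmentClass_add_of_map_eq_zero l.2 l'.1
  ModuleCat.ofHom { f with map_smul' n l := (map_zsmul f n l).trans (int_smul_eq_zsmul _ n _).symm }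

theorem loopClass_apply (l : p.toAddMonoidHom.ker) : (loopClass p).hom l = segmentClass p l.1 :=
  rfl

variable (hp : IsCoveringMap p) (hsurj : Function.Surjective p)

/-- The element of the kernel of `p` obtained by closing up the path `σ`: its end points are joined
to the origin by the images of the segments to a chosen preimage of each. -/
noncomputable def closing (σ : C(stdSimplex ℝ (Fin 2), A)) : p.toAddMonoidHom.ker :=
  ⟨displacement hp hsurj σ - (Function.surjInv hsurj (σ (stdSimplex.vertex 1)) -
    Function.surjInv hsurj (σ (stdSimplex.vertex 0))), by
    obtain ⟨F, rfl⟩ := exists_comp_eq_of_isCoveringMap (p := p.toContinuousMap) hp hsurj σ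
    rw [displacement_comp]
    change p _ = 0
    simp only [map_sub, Function.surjInv_eq hsurj]
    exact sub_self _⟩

theorem pOpcycles_single_eq_loopClass_closing_add (σ : C(stdSimplex ℝ (Fin 2), A)) :
    ((complex A).pOpcycles 1).hom (single σ) = (loopClass p).hom (closing hp hsurj σ) +
      (segmentClass p (Function.surjInv hsurj (σ (stdSimplex.vertex 1))) -
        segmentClass p (Function.surjInv hsurj (σ (stdSimplex.vertex 0)))) := by
  obtain ⟨F, rfl⟩ := exists_comp_eq_of_isCoveringMap (p := p.toContinuousMap) hp hsurj σ
  let q := Function.surjInv hsurj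
  let deck (t : stdSimplex ℝ (Fin 2)) : p.toAddMonoidHom.ker :=
    ⟨F t - q (p (F t)), by
      change p _ = 0
      rw [map_sub, Function.surjInv_eq hsurj, sub_self]⟩
  have hdeck (t) : segmentClass p (F t) =
      (loopClass p).hom (deck t) + segmentClass p (q (p (F t))) := by
    rw [loopClass_apply, ← segmentClass_add_of_map_eq_zero (deck t).2, sub_add_cancel]
  have hclosing : closing hp hsurj (p.toContinuousMap.comp F) =
      deck (stdSimplex.vertex 1) - deck (stdSimplex.vertex 0) := by
    refine Subtype.ext ?_
    change displacement hp hsurj _ - _ = (_ - _) - (_ - _)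
    rw [displacement_comp]
    exact sub_sub_sub_comm _ _ _ _
  rw [pOpcycles_single_comp, hdeck, hdeck, hclosing, map_sub]
  exact add_sub_add_comm _ _ _ _

theorem pOpcycles_eq_desc_closing_comp_loopClass_add :
    (complex A).pOpcycles 1 =
      desc (M := ModuleCat.of ℤ p.toAddMonoidHom.ker) (closing hp hsurj) ≫ loopClass p +
        (complex A).d 1 0 ≫
          desc fun x => segmentClass p (Function.surjInv hsurj (x (stdSimplex.vertex 0))) := by
  refine hom_ext fun σ => ?_
  rw [pOpcycles_single_eq_loopClass_closing_add hp hsurj, ModuleCat.hom_add, LinearMap.add_apply,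
    ModuleCat.comp_apply, ModuleCat.comp_apply, d_single_one, map_sub, desc_single, desc_single,
    desc_single]
  rfl

include hp hsurj in
theorem exists_homologyι_eq_loopClass (c : H1 A) : ∃ l : p.toAddMonoidHom.ker,
    ((complex A).homologyι 1).hom c = (loopClass p).hom l := by
  obtain ⟨z, hz⟩ := pOpcycles_surjective (complex A) 1 (((complex A).homologyι 1).hom c)
  have hdz : ((complex A).d 1 0).hom z = 0 := by
    rw [← fromOpcycles_pOpcycles_apply, hz]
    exact congrArg (fun f => f.hom c) ((complex A).homologyι_comp_fromOpcycles 1 0)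
  refine ⟨(desc (M := ModuleCat.of ℤ p.toAddMonoidHom.ker) (closing hp hsurj)).hom z, ?_⟩
  rw [← hz, pOpcycles_eq_desc_closing_comp_loopClass_add hp hsurj, ModuleCat.hom_add,
    LinearMap.add_apply, ModuleCat.comp_apply, ModuleCat.comp_apply, hdz, map_zero, add_zero]

theorem homologyι_eq_segmentClass_period (c : H1 A) :
    ((complex A).homologyι 1).hom c = segmentClass p (period hp hsurj c) ∧
      p (period hp hsurj c) = 0 := by
  obtain ⟨l, hl⟩ := exists_homologyι_eq_loopClass hp hsurj c
  have hperiod : period hp hsurj c = l := by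
    rw [period_apply, hl, loopClass_apply, opcyclesDisplacement_segmentClass]
  rw [hperiod]
  exact ⟨hl, l.2⟩

theorem period_injective : Function.Injective (period hp hsurj) := fun c c' h =>
  homologyι_injective (complex A) 1 <| by
    rw [(homologyι_eq_segmentClass_period hp hsurj c).1, h,
      (homologyι_eq_segmentClass_period hp hsurj c').1]

theorem exists_period_eq {l : V} (hl : p l = 0) : ∃ c, period hp hsurj c = l := by
  obtain ⟨c, hc⟩ : ∃ c : H1 A, ((complex A).homologyι 1).hom c = segmentClass p l :=
    exists_homologyι_eq (complex A) (by simp) (fromOpcycles_segmentClass hl)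
  exact ⟨c, by rw [period_apply, hc, opcyclesDisplacement_segmentClass]⟩

theorem period_H1map {W B : Type} [AddCommGroup W] [TopologicalSpace W] [IsTopologicalAddGroup W]
    [Module ℝ W] [ContinuousSMul ℝ W] [AddGroup B] [TopologicalSpace B] {r : W →ₜ+ B}
    (hr : IsCoveringMap r) (hrsurj : Function.Surjective r) {f : C(A, B)} {T : V →ₜ+ W}
    (h : ∀ v, f (p v) = r (T v)) (c : H1 A) :
    period hr hrsurj (H1map f c) = T (period hp hsurj c) := by
  have hcomp (v : V) : f.comp (p.toContinuousMap.comp (segment v)) =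
      r.toContinuousMap.comp (T.toContinuousMap.comp (segment v)) :=
    ContinuousMap.ext fun t => h (segment v t)
  have hι : ((complex B).homologyι 1).hom (H1map f c) =
      (HomologicalComplex.opcyclesMap (map f) 1).hom (((complex A).homologyι 1).hom c) :=
    homologyι_homologyMap_apply (map f) 1 c
  rw [period_apply, hι, (homologyι_eq_segmentClass_period hp hsurj c).1, segmentClass,
    opcyclesMap_pOpcycles_apply, map_single, hcomp, opcyclesDisplacement_pOpcycles, desc_single,
    displacement_comp]
  change T (segment _ _) - T (segment _ _) = _
  rw [segment_vertex_one, segment_vertex_zero, map_zero, sub_zero]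

end Period

end VectorCovering

section CoveringHom

variable {V A : Type*} [AddGroup V] [TopologicalSpace V] [AddGroup A] [TopologicalSpace A]
  {p : V →ₜ+ A}

theorem isDiscrete_ker_of_isCoveringMap (hp : IsCoveringMap p) :
    IsDiscrete (p.toAddMonoidHom.ker : Set V) :=
  ⟨(hp 0).discreteTopology_fiber⟩

theorem isCoveringMap_of_isOpenMap_of_isDiscrete_ker [IsTopologicalAddGroup V]
    (ho : IsOpenMap p) (hsurj : Function.Surjective p)
    (hd : IsDiscrete (p.toAddMonoidHom.ker : Set V)) : IsCoveringMap p :=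
  have hq : Topology.IsQuotientMap p := ho.isQuotientMap p.continuous_toFun hsurj
  (hq.isAddQuotientCoveringMap_of_isDiscrete_ker_addMonoidHom (f := p.toAddMonoidHom)
    hd).isCoveringMap

end CoveringHom

theorem exists_continuousLinearMap_lift {V W A B : Type*}
    [AddCommGroup V] [TopologicalSpace V] [IsTopologicalAddGroup V] [Module ℝ V]
    [ContinuousSMul ℝ V] [LocallyConvexSpace ℝ V]
    [AddCommGroup W] [TopologicalSpace W] [IsTopologicalAddGroup W] [Module ℝ W]
    [ContinuousSMul ℝ W] [T2Space W]
    [AddGroup A] [TopologicalSpace A] [AddGroup B] [TopologicalSpace B]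
    (p : V →ₜ+ A) {r : W →ₜ+ B} (hr : IsCoveringMap r) (f : A →ₜ+ B) :
    ∃ T : V →L[ℝ] W, ∀ v, f (p v) = r (T v) := by
  obtain ⟨F, ⟨hF0, hF⟩, -⟩ := hr.existsUnique_continuousMap_lifts
    (f.comp p).toContinuousMap (0 : V) (0 : W) ((map_zero r).trans (map_zero (f.comp p)).symm)
  have hF' (v : V) : r (F v) = f (p v) := congrFun hF v
  have hadd (v w : V) : F (v + w) = F v + F w := by
    have h := lift_sub_lift_eq hr (F := F.comp ⟨fun v => v + w, by fun_prop⟩)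
      (G := ⟨fun v => F v + F w, by fun_prop⟩)
      (ContinuousMap.ext fun v => by
        change r (F (v + w)) = r (F v + F w)
        simp only [map_add, hF']) v 0
    change F (v + w) - F (0 + w) = F v + F w - (F 0 + F w) at h
    rwa [zero_add, hF0, zero_add, sub_left_inj] at h
  exact ⟨(AddMonoidHom.mk' F hadd).toRealLinearMap F.continuous, fun v => (hF' v).symm⟩

section KernelComponent

open VectorCovering

variable {V W A B : Type} [AddCommGroup V] [TopologicalSpace V] [Module ℝ V]
  [AddCommGroup W] [TopologicalSpace W] [Module ℝ W]
  [AddCommGroup A] [TopologicalSpace A] [AddCommGroup B] [TopologicalSpace B]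
  {p : V →ₜ+ A} {r : W →ₜ+ B} {f : A →ₜ+ B} {T : V →L[ℝ] W} (hT : ∀ v, f (p v) = r (T v))
  {S : AddSubgroup A} (hS : ∀ a, a ∈ S ↔ f a = 0)

/-- For a lift `T` of `f` along the coverings `p` and `r`, the restriction of `p` to `ker T`, with
values in the kernel `S` of `f`. -/
def restrictKer : T.toLinearMap.ker →ₜ+ S where
  toFun v := ⟨p v, by
    have hv : T v = 0 := v.2
    rw [hS, hT, hv, map_zero]⟩
  map_zero' := Subtype.ext (map_zero p)
  map_add' v w := Subtype.ext (map_add p v.1 w.1)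
  continuous_toFun := by fun_prop

theorem isOpenMap_restrictKer (hp : IsOpenMap p) (hr : IsDiscrete (r.toAddMonoidHom.ker : Set W)) :
    IsOpenMap (restrictKer hT hS) := by
  obtain ⟨N, hN, hNker⟩ := isDiscrete_iff_forall_mem_exists_isOpen.mp hr 0 (map_zero r)
  have hN0 (w : W) (hw : r w = 0) : w ∈ N ↔ w = 0 :=
    (and_iff_left hw).symm.trans (Set.ext_iff.mp hNker w)
  rintro _ ⟨O, hO, rfl⟩
  refine ⟨p '' (O ∩ T ⁻¹' N), hp _ (hO.inter (hN.preimage T.continuous)), ?_⟩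
  ext P
  constructor
  · rintro ⟨v, ⟨hvO, hvN⟩, hvP⟩
    have hrT : r (T v) = 0 := by rw [← hT, hvP, (hS _).mp P.2]
    exact ⟨⟨v, (hN0 _ hrT).mp hvN⟩, hvO, Subtype.ext hvP⟩
  · rintro ⟨v, hvO, rfl⟩
    have hTv : T v = 0 := v.2
    exact ⟨v, ⟨hvO, (hN0 _ (by rw [hTv, map_zero])).mpr hTv⟩, rfl⟩

variable [IsTopologicalAddGroup V] [ContinuousSMul ℝ V] [IsTopologicalAddGroup A]

theorem range_restrictKer (hp : IsOpenMap p) (hr : IsDiscrete (r.toAddMonoidHom.ker : Set W)) :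
    Set.range (restrictKer hT hS) = connectedComponent (0 : S) := by
  refine Set.Subset.antisymm ?_ ?_
  · exact (isPreconnected_range (restrictKer hT hS).continuous_toFun).subset_connectedComponent
      ⟨0, map_zero (restrictKer hT hS)⟩
  · have ho : IsOpen ((restrictKer hT hS).toAddMonoidHom.range : Set S) :=
      (isOpenMap_restrictKer hT hS hp hr).isOpen_range
    exact IsClopen.connectedComponent_subset ⟨AddSubgroup.isClosed_of_isOpen _ ho, ho⟩
      (zero_mem (restrictKer hT hS).toAddMonoidHom.range)

/-- `restrictKer` as a map onto the identity component of `S`. -/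
def kernelComponentCovering (hp : IsOpenMap p) (hr : IsDiscrete (r.toAddMonoidHom.ker : Set W)) :
    T.toLinearMap.ker →ₜ+ AddSubgroup.connectedComponentOfZero S where
  toFun v := ⟨restrictKer hT hS v, (range_restrictKer hT hS hp hr).le ⟨v, rfl⟩⟩
  map_zero' := Subtype.ext (map_zero (restrictKer hT hS))
  map_add' v w := Subtype.ext (map_add (restrictKer hT hS) v w)
  continuous_toFun := (restrictKer hT hS).continuous_toFun.subtype_mk _

theorem kernelComponentCovering_surjective (hp : IsOpenMap p)
    (hr : IsDiscrete (r.toAddMonoidHom.ker : Set W)) :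
    Function.Surjective (kernelComponentCovering hT hS hp hr) := by
  rintro ⟨P, hP⟩
  obtain ⟨v, rfl⟩ := (range_restrictKer hT hS hp hr).ge hP
  exact ⟨v, rfl⟩

theorem isCoveringMap_kernelComponentCovering (hp : IsCoveringMap p)
    (hr : IsDiscrete (r.toAddMonoidHom.ker : Set W)) :
    IsCoveringMap (kernelComponentCovering hT hS hp.isOpenMap hr) := by
  refine isCoveringMap_of_isOpenMap_of_isDiscrete_ker ?_
    (kernelComponentCovering_surjective hT hS hp.isOpenMap hr) ?_
  · exact (isOpenMap_restrictKer hT hS hp.isOpenMap hr).subtype_mk _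
  · exact ((isDiscrete_ker_of_isCoveringMap hp).preimage continuous_subtype_val.continuousOn
      Subtype.val_injective).mono fun v hv =>
        congrArg (fun P : AddSubgroup.connectedComponentOfZero S => P.1.1) hv

variable (S) in
/-- The inclusion in `A` of the identity component of a subgroup `S`. -/
def componentInclusion : C(AddSubgroup.connectedComponentOfZero S, A) where
  toFun P := P.1.1
  continuous_toFun := continuous_subtype_val.comp continuous_subtype_val

variable (hp : IsCoveringMap p) (hr : IsDiscrete (r.toAddMonoidHom.ker : Set W))
  (hsurj : Function.Surjective p)

theorem period_H1map_componentInclusion (c : H1 (AddSubgroup.connectedComponentOfZero S)) :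
    period hp hsurj (H1map (componentInclusion S) c) =
      period (isCoveringMap_kernelComponentCovering hT hS hp hr)
        (kernelComponentCovering_surjective hT hS hp.isOpenMap hr) c :=
  period_H1map (T := (T.toLinearMap.ker.subtypeL : T.toLinearMap.ker →ₜ+ V)) _ _ hp hsurj
    (fun _ => rfl) c

include hT hS hp hr hsurj

theorem H1map_componentInclusion_injective :
    Function.Injective (H1map (componentInclusion S)) := fun b c h => by
  refine period_injective (isCoveringMap_kernelComponentCovering hT hS hp hr)
    (kernelComponentCovering_surjective hT hS hp.isOpenMap hr) (Subtype.ext ?_)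
  rw [← period_H1map_componentInclusion hT hS hp hr hsurj, h,
    period_H1map_componentInclusion hT hS hp hr hsurj]

theorem mem_range_H1map_componentInclusion_iff (c : H1 A) :
    c ∈ (H1map (componentInclusion S)).range ↔ T (period hp hsurj c) = 0 := by
  constructor
  · rintro ⟨b, rfl⟩
    rw [period_H1map_componentInclusion hT hS hp hr hsurj]
    exact LinearMap.mem_ker.mp (SetLike.coe_mem _)
  · intro h
    let l : T.toLinearMap.ker := ⟨period hp hsurj c, h⟩
    obtain ⟨b, hb⟩ := exists_period_eq (isCoveringMap_kernelComponentCovering hT hS hp hr)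
      (kernelComponentCovering_surjective hT hS hp.isOpenMap hr) (l := l)
      (Subtype.ext (Subtype.ext (homologyι_eq_segmentClass_period hp hsurj c).2))
    refine ⟨b, period_injective hp hsurj ?_⟩
    rw [period_H1map_componentInclusion hT hS hp hr hsurj, hb]

omit hT hS hr [IsTopologicalAddGroup A] in
theorem H1map_eq_neg_iff {g : C(A, A)} {T : V →L[ℝ] V} (hT : ∀ v, g (p v) = p (T v)) (c : H1 A) :
    H1map g c = -c ↔ (T + .id ℝ V) (period hp hsurj c) = 0 := by
  rw [← (period_injective hp hsurj).eq_iff, map_neg,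
    period_H1map hp hsurj hp hsurj (T := (T : V →ₜ+ V)) hT, eq_neg_iff_add_eq_zero]
  rfl

end KernelComponent

/-! ### Extension of local homomorphisms -/

section LocalHom

open Topology Filter

section Extension

variable {V A : Type*} [AddCommGroup V] [Module ℝ V] [TopologicalSpace V] [ContinuousSMul ℝ V]
  [AddCommGroup A]

theorem tendsto_two_inv_pow_smul (v : V) :
    Tendsto (fun n : ℕ => ((2 : ℝ)⁻¹ ^ n) • v) atTop (𝓝 0) := by
  have h := (tendsto_pow_atTop_nhds_zero_of_lt_one (r := (2 : ℝ)⁻¹) (by norm_num)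
    (by norm_num)).smul_const v
  rwa [zero_smul] at h

omit [TopologicalSpace V] [ContinuousSMul ℝ V] in
theorem two_pow_succ_smul_apply {e : V → A} {v : V} {n : ℕ}
    (h : e (((2 : ℝ)⁻¹ ^ (n + 1)) • v + ((2 : ℝ)⁻¹ ^ (n + 1)) • v) =
      e (((2 : ℝ)⁻¹ ^ (n + 1)) • v) + e (((2 : ℝ)⁻¹ ^ (n + 1)) • v)) :
    2 ^ (n + 1) • e (((2 : ℝ)⁻¹ ^ (n + 1)) • v) = 2 ^ n • e (((2 : ℝ)⁻¹ ^ n) • v) := by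
  have hv : ((2 : ℝ)⁻¹ ^ (n + 1)) • v + ((2 : ℝ)⁻¹ ^ (n + 1)) • v = ((2 : ℝ)⁻¹ ^ n) • v := by
    rw [← add_smul, ← two_mul, pow_succ', mul_inv_cancel_left₀ two_ne_zero]
  rw [pow_succ, mul_smul, two_smul, ← h, hv]

theorem exists_eventually_eq_of_local_add {e : V → A}
    (hadd : ∀ᶠ x : V × V in 𝓝 (0, 0), e (x.1 + x.2) = e x.1 + e x.2) (v : V) :
    ∃ a : A, ∀ᶠ n : ℕ in atTop, 2 ^ n • e (((2 : ℝ)⁻¹ ^ n) • v) = a := by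
  have h := (tendsto_two_inv_pow_smul v).comp (tendsto_add_atTop_nat 1)
  obtain ⟨N, hN⟩ := eventually_atTop.mp ((h.prodMk_nhds h).eventually hadd)
  refine ⟨2 ^ N • e (((2 : ℝ)⁻¹ ^ N) • v), eventually_atTop.mpr ⟨N, fun n hn => ?_⟩⟩
  induction n, hn using Nat.le_induction with
  | base => rfl
  | succ n hn ih => exact (two_pow_succ_smul_apply (hN n hn)).trans ih

theorem eventually_two_pow_smul_apply_eq {e : V → A}
    (hadd : ∀ᶠ x : V × V in 𝓝 (0, 0), e (x.1 + x.2) = e x.1 + e x.2) :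
    ∀ᶠ v in 𝓝 0, ∀ n : ℕ, 2 ^ n • e (((2 : ℝ)⁻¹ ^ n) • v) = e v := by
  have hdiag : Tendsto (fun v : V => (v, v)) (𝓝 0) (𝓝 (0, 0)) := tendsto_id.prodMk_nhds tendsto_id
  obtain ⟨U, ⟨hU, hbal⟩, hUadd⟩ := (nhds_basis_balanced ℝ V).mem_iff.mp (hdiag.eventually hadd)
  filter_upwards [hU] with v hv n
  induction n with
  | zero => simp only [pow_zero, one_smul]
  | succ n ih =>
    have hmem : ((2 : ℝ)⁻¹ ^ (n + 1)) • v ∈ U := hbal.smul_mem (by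
      rw [norm_pow]
      exact pow_le_one₀ (norm_nonneg _) (by norm_num)) hv
    exact (two_pow_succ_smul_apply (hUadd hmem)).trans ih

/- The extension is `v ↦ 2 ^ n • e (2⁻ⁿ • v)` for large `n`. -/
theorem exists_addMonoidHom_eventuallyEq {e : V → A}
    (hadd : ∀ᶠ x : V × V in 𝓝 (0, 0), e (x.1 + x.2) = e x.1 + e x.2) :
    ∃ p : V →+ A, p =ᶠ[𝓝 0] e := by
  choose p hp using exists_eventually_eq_of_local_add hadd
  refine ⟨AddMonoidHom.mk' p fun v w => ?_, ?_⟩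
  · have h := ((tendsto_two_inv_pow_smul v).prodMk_nhds (tendsto_two_inv_pow_smul w)).eventually
      hadd
    obtain ⟨n, hn, hv, hw, hvw⟩ := (h.and ((hp v).and ((hp w).and (hp (v + w))))).exists
    rw [← hv, ← hw, ← hvw, smul_add ((2 : ℝ)⁻¹ ^ n), hn, smul_add]
  · filter_upwards [eventually_two_pow_smul_apply_eq hadd] with v hv
    obtain ⟨n, hn⟩ := (hp v).exists
    exact hn.symm.trans (hv n)

end Extension

section Germ

variable {V A : Type*} [AddCommGroup V] [TopologicalSpace V] [AddCommGroup A]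
  {p : V →+ A} {l : A → V}

theorem isDiscrete_ker_of_eventually_leftInverse [IsTopologicalAddGroup V]
    (hlp : ∀ᶠ v in 𝓝 0, l (p v) = v) : IsDiscrete (p.ker : Set V) := by
  have hl0 : l 0 = 0 := by simpa only [map_zero] using hlp.self_of_nhds
  obtain ⟨U, hU, hUo, h0⟩ := mem_nhds_iff.mp hlp
  refine ⟨discreteTopology_of_isOpen_singleton_zero (G := p.ker) ⟨U, hUo, ?_⟩⟩
  ext v
  refine ⟨fun hv => Subtype.ext ?_, fun hv => hv ▸ h0⟩
  rw [← hU hv, AddMonoidHom.mem_ker.mp v.2, hl0, ZeroMemClass.coe_zero]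

theorem isOpenMap_of_eventually_rightInverse [TopologicalSpace A] [IsTopologicalAddGroup V]
    [ContinuousAdd A] (hl : Tendsto l (𝓝 0) (𝓝 0)) (hpl : ∀ᶠ a in 𝓝 0, p (l a) = a) :
    IsOpenMap p :=
  IsTopologicalAddGroup.isOpenMap_iff_nhds_zero.mpr <| calc
    𝓝 (0 : A) = map (p ∘ l) (𝓝 0) := ((map_congr hpl).trans map_id).symm
    _ = map p (map l (𝓝 0)) := map_map.symm
    _ ≤ map p (𝓝 0) := map_mono hl

end Germ

theorem eventually_add_of_local_inverse {V A : Type*} [AddCommGroup V] [TopologicalSpace V]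
    [AddCommGroup A] [TopologicalSpace A] [ContinuousAdd A] {e : V → A} {l : A → V}
    (hladd : ∀ᶠ x : A × A in 𝓝 (0, 0), l (x.1 + x.2) = l x.1 + l x.2)
    (he : Tendsto e (𝓝 0) (𝓝 0)) (hle : ∀ᶠ v in 𝓝 0, l (e v) = v)
    (hel : ∀ᶠ a in 𝓝 0, e (l a) = a) :
    ∀ᶠ x : V × V in 𝓝 (0, 0), e (x.1 + x.2) = e x.1 + e x.2 := by
  have hfst : Tendsto Prod.fst (𝓝 ((0 : V), (0 : V))) (𝓝 0) := continuous_fst.tendsto _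
  have hsnd : Tendsto Prod.snd (𝓝 ((0 : V), (0 : V))) (𝓝 0) := continuous_snd.tendsto _
  have hpair : Tendsto (fun x : V × V => (e x.1, e x.2)) (𝓝 (0, 0)) (𝓝 (0, 0)) :=
    (he.comp hfst).prodMk_nhds (he.comp hsnd)
  have hsum : Tendsto (fun x : V × V => e x.1 + e x.2) (𝓝 (0, 0)) (𝓝 0) :=
    (tendsto_add.comp hpair).trans_eq (congrArg 𝓝 (add_zero 0))
  filter_upwards [hpair.eventually hladd, hfst.eventually hle, hsnd.eventually hle,
    hsum.eventually hel] with x hadd hv hw hvw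
  rw [← hvw, hadd, hv, hw]

theorem exists_isOpenMap_isDiscrete_ker_of_local_log {V A : Type*} [AddCommGroup V] [Module ℝ V]
    [TopologicalSpace V] [IsTopologicalAddGroup V] [ContinuousSMul ℝ V] [AddCommGroup A]
    [TopologicalSpace A] [IsTopologicalAddGroup A] {e : V → A} {l : A → V}
    (hladd : ∀ᶠ x : A × A in 𝓝 (0, 0), l (x.1 + x.2) = l x.1 + l x.2)
    (he : Tendsto e (𝓝 0) (𝓝 0)) (hl : Tendsto l (𝓝 0) (𝓝 0))
    (hle : ∀ᶠ v in 𝓝 0, l (e v) = v) (hel : ∀ᶠ a in 𝓝 0, e (l a) = a) :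
    ∃ p : V →ₜ+ A, IsOpenMap p ∧ IsDiscrete (p.toAddMonoidHom.ker : Set V) := by
  obtain ⟨p, hp⟩ :=
    exists_addMonoidHom_eventuallyEq (eventually_add_of_local_inverse hladd he hle hel)
  have hcont : Continuous p := continuous_of_continuousAt_zero p (by
    rw [ContinuousAt, map_zero]
    exact he.congr' hp.symm)
  refine ⟨⟨p, hcont⟩, isOpenMap_of_eventually_rightInverse (p := p) hl ?_,
    isDiscrete_ker_of_eventually_leftInverse (l := l) ?_⟩
  · filter_upwards [hl.eventually hp, hel] with a ha hela
    exact ha.trans hela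
  · filter_upwards [hp, hle] with v hv hlev
    rwa [hv]

end LocalHom

section SquareRoot

open Topology Filter

theorem exists_differentiable_sqrt {f : ℂ → ℂ} (hf : Differentiable ℂ f) {x₀ s₀ : ℂ}
    (hs₀ : s₀ ^ 2 = f x₀) (h0 : s₀ ≠ 0) :
    ∃ r > 0, ∃ s : ℂ → ℂ, s x₀ = s₀ ∧ ∀ x ∈ Metric.ball x₀ r,
      s x ^ 2 = f x ∧ DifferentiableAt ℂ s x ∧ s x ≠ 0 := by
  have hf0 : f x₀ ≠ 0 := hs₀ ▸ pow_ne_zero 2 h0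
  have hd : Differentiable ℂ fun x => f x / f x₀ := hf.div_const _
  have hev : ∀ᶠ x in 𝓝 x₀, f x / f x₀ ∈ Complex.slitPlane := by
    refine hd.continuous.continuousAt.eventually_mem (Complex.isOpen_slitPlane.mem_nhds ?_)
    rw [div_self hf0]
    exact Complex.one_mem_slitPlane
  obtain ⟨r, hr, hball⟩ := Metric.eventually_nhds_iff_ball.mp hev
  refine ⟨r, hr, fun x => s₀ * Complex.exp (Complex.log (f x / f x₀) / 2), ?_, fun x hx =>
    ⟨?_, (((hd x).clog (hball x hx)).div_const 2).cexp.const_mul s₀,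
      mul_ne_zero h0 (Complex.exp_ne_zero _)⟩⟩
  · simp [div_self hf0]
  · rw [mul_pow, ← Complex.exp_nat_mul, hs₀, Nat.cast_ofNat, mul_div_cancel₀ _ two_ne_zero,
      Complex.exp_log (Complex.slitPlane_ne_zero (hball x hx)), mul_div_cancel₀ _ hf0]

theorem exists_sq_eq_norm_sub_sq_le (a b : ℂ) : ∃ z : ℂ, z ^ 2 = a ∧ ‖z - b‖ ^ 2 ≤ ‖a - b ^ 2‖ := by
  obtain ⟨s, hs⟩ := IsAlgClosed.exists_pow_nat_eq a two_pos
  have h : ‖s - b‖ * ‖s + b‖ = ‖a - b ^ 2‖ := by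
    rw [← norm_mul, ← hs]
    ring_nf
  -- Take the square root of `a` that is closer to `b`.
  rcases le_total ‖s - b‖ ‖s + b‖ with hle | hle
  · refine ⟨s, hs, ?_⟩
    rw [sq, ← h]
    gcongr
  · refine ⟨-s, by rw [neg_sq, hs], ?_⟩
    rw [← neg_add', norm_neg, sq, ← h]
    gcongr

theorem exists_sqrt_continuousAt {X : Type*} [TopologicalSpace X] {f : X → ℂ} {x₀ : X} {s₀ : ℂ}
    (hf : ContinuousAt f x₀) (hs₀ : s₀ ^ 2 = f x₀) :
    ∃ s : X → ℂ, s x₀ = s₀ ∧ ContinuousAt s x₀ ∧ ∀ x, s x ^ 2 = f x := by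
  choose s hs hle using fun x => exists_sq_eq_norm_sub_sq_le (f x) s₀
  have hx₀ : s x₀ = s₀ := by
    have h := hle x₀
    rw [hs₀, sub_self, norm_zero] at h
    exact sub_eq_zero.mp (norm_eq_zero.mp (sq_nonpos_iff _ |>.mp h))
  have hlim : Tendsto (fun x => ‖f x - s₀ ^ 2‖) (𝓝 x₀) (𝓝 0) := by
    rw [hs₀]
    exact tendsto_iff_norm_sub_tendsto_zero.mp hf
  refine ⟨s, hx₀, ?_, hs⟩
  rw [ContinuousAt, hx₀, tendsto_iff_norm_sub_tendsto_zero]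
  exact squeeze_zero (fun _ => norm_nonneg _) (fun x => Real.le_sqrt_of_sq_le (hle x))
    (Real.sqrt_zero ▸ hlim.sqrt)

end SquareRoot

/-! ### The topological group of complex points -/

namespace ComplexPoints

open WeierstrassCurve Topology Filter
open scoped WeierstrassCurve.Projective

variable {E : WeierstrassCurve ℝ}

/-- The nonsingular homogeneous coordinate vectors of points of `E(ℂ)`, with the topology of
`ℂ³`, which present `E(ℂ)` as an open quotient. -/
abbrev Cone (E : WeierstrassCurve ℝ) : Type :=
  {v : Fin 3 → ℂ // (E.baseChange ℂ).toProjective.Nonsingular v}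

/-- The point of `E(ℂ)` with given homogeneous coordinates. -/
noncomputable def ofCone (v : Cone E) : ComplexPoints E :=
  Projective.Point.toAffine (E.baseChange ℂ) v.1

@[fun_prop]
theorem Cone.continuous_coord (i : Fin 3) : Continuous fun v : Cone E => v.1 i :=
  (continuous_apply i).comp continuous_subtype_val

theorem Cone.ne_zero (v : Cone E) : v.1 ≠ 0 := fun h => by
  have hv := v.2
  rw [h, Projective.nonsingular_of_Z_eq_zero rfl] at hv
  simp at hv

theorem toProjectivePlane_ofCone (v : Cone E) :
    toProjectivePlane E (ofCone v) = Projectivization.mk ℂ v.1 v.ne_zero := by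
  by_cases hz : v.1 2 = 0
  · rw [ofCone, Projective.Point.toAffine_of_Z_eq_zero hz]
    have hx := Projective.X_eq_zero_of_Z_eq_zero v.2.1 hz
    have hy := (Projective.isUnit_Y_of_Z_eq_zero v.2 hz).ne_zero
    refine (Projectivization.mk_eq_mk_iff' ℂ _ _ _ _).mpr ⟨(v.1 1)⁻¹, funext fun i => ?_⟩
    fin_cases i
    · simp [hx]
    · simp [hy]
    · simp [hz]
  · rw [ofCone, Projective.Point.toAffine_of_Z_ne_zero v.2 hz]
    refine (Projectivization.mk_eq_mk_iff' ℂ _ _ _ _).mpr ⟨(v.1 2)⁻¹, funext fun i => ?_⟩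
    fin_cases i
    · simp [div_eq_inv_mul]
    · simp [div_eq_inv_mul]
    · simp [hz]

theorem ofCone_surjective : Function.Surjective (ofCone (E := E)) := by
  rintro (_ | ⟨x, y, h⟩)
  · exact ⟨⟨_, Projective.nonsingular_zero⟩, Projective.Point.toAffine_zero⟩
  · have hv := (Projective.nonsingular_some x y).mpr h
    exact ⟨⟨_, hv⟩, Projective.Point.toAffine_some hv⟩

theorem ofCone_eq_iff {v w : Cone E} : ofCone v = ofCone w ↔ v.1 ≈ w.1 := by
  refine ⟨fun h => ?_, Projective.Point.toAffine_of_equiv⟩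
  have h' := congrArg (toProjectivePlane E) h
  rw [toProjectivePlane_ofCone, toProjectivePlane_ofCone] at h'
  exact (Projectivization.mk_eq_mk_iff ℂ _ _ _ _).mp h'

theorem ofCone_ne_zero_iff (v : Cone E) : ofCone v ≠ 0 ↔ v.1 2 ≠ 0 := by
  refine ⟨mt Projective.Point.toAffine_of_Z_eq_zero, fun h => ?_⟩
  rw [ofCone, Projective.Point.toAffine_of_Z_ne_zero v.2 h]
  exact Affine.Point.some_ne_zero _

theorem exists_ofCone_eq_of_mk_eq {u : Fin 3 → ℂ} (hu : u ≠ 0) (v : Cone E)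
    (h : Projectivization.mk ℂ u hu = Projectivization.mk ℂ v.1 v.ne_zero) :
    ∃ w : Cone E, w.1 = u ∧ ofCone w = ofCone v := by
  obtain ⟨a, rfl⟩ := (Projectivization.mk_eq_mk_iff ℂ _ _ _ _).mp h
  exact ⟨⟨_, (Projective.nonsingular_smul v.1 a.isUnit).mpr v.2⟩, rfl,
    Projective.Point.toAffine_smul v.1 a.isUnit⟩

theorem isOpenMap_projectivization_mk :
    IsOpenMap (Projectivization.mk' ℂ : {v : Fin 3 → ℂ // v ≠ 0} → ℙ ℂ (Fin 3 → ℂ)) := by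
  intro U hU
  have hpreimage : Projectivization.mk' ℂ ⁻¹' (Projectivization.mk' ℂ '' U) =
      ⋃ a : ℂˣ, (fun v : {v : Fin 3 → ℂ // v ≠ 0} =>
        (⟨(a : ℂ) • v.1, smul_ne_zero a.ne_zero v.2⟩ : {v : Fin 3 → ℂ // v ≠ 0})) ⁻¹' U := by
    ext v
    simp only [Set.mem_preimage, Set.mem_image, Set.mem_iUnion]
    constructor
    · rintro ⟨u, hu, huv⟩
      obtain ⟨a, ha⟩ := (Projectivization.mk_eq_mk_iff ℂ _ _ u.2 v.2).mp huv
      have hua : u = ⟨(a : ℂ) • v.1, smul_ne_zero a.ne_zero v.2⟩ := Subtype.ext ha.symm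
      exact ⟨a, hua ▸ hu⟩
    · rintro ⟨a, ha⟩
      exact ⟨_, ha, (Projectivization.mk_eq_mk_iff ℂ _ _ _ v.2).mpr ⟨a, rfl⟩⟩
  refine isOpen_coinduced.mpr ?_
  rw [hpreimage]
  exact isOpen_iUnion fun a => hU.preimage (by fun_prop)

theorem continuous_ofCone : Continuous (ofCone (E := E)) := by
  have hcomp : toProjectivePlane E ∘ ofCone =
      Projectivization.mk' ℂ ∘ fun v : Cone E => ⟨v.1, v.ne_zero⟩ :=
    funext toProjectivePlane_ofCone
  refine continuous_induced_rng.mpr ?_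
  rw [hcomp]
  exact continuous_coinduced_rng.comp (by fun_prop)

theorem isOpenMap_ofCone : IsOpenMap (ofCone (E := E)) := by
  rintro _ ⟨U, hU, rfl⟩
  refine ⟨Projectivization.mk' ℂ '' (Subtype.val ⁻¹' U), isOpenMap_projectivization_mk _
    (hU.preimage continuous_subtype_val), ?_⟩
  ext P
  obtain ⟨v, rfl⟩ := ofCone_surjective P
  simp only [Set.mem_preimage, Set.mem_image]
  rw [toProjectivePlane_ofCone]
  constructor
  · rintro ⟨u, hu, huv⟩
    obtain ⟨w, hwu, hw⟩ := exists_ofCone_eq_of_mk_eq u.2 v huv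
    exact ⟨w, hwu ▸ hu, hw⟩
  · rintro ⟨w, hw, hwv⟩
    refine ⟨⟨w.1, w.ne_zero⟩, hw, ?_⟩
    have h := congrArg (toProjectivePlane E) hwv
    rwa [toProjectivePlane_ofCone, toProjectivePlane_ofCone] at h

theorem isOpenQuotientMap_ofCone : IsOpenQuotientMap (ofCone (E := E)) :=
  ⟨ofCone_surjective, continuous_ofCone, isOpenMap_ofCone⟩

theorem isClosed_singleton_zero : IsClosed ({0} : Set (ComplexPoints E)) := by
  have hpreimage : ofCone ⁻¹' ({0} : Set (ComplexPoints E)) = {v : Cone E | v.1 2 = 0} :=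
    Set.ext fun v => not_iff_not.mp (ofCone_ne_zero_iff v)
  rw [← isOpenQuotientMap_ofCone.isQuotientMap.isClosed_preimage, hpreimage]
  exact isClosed_eq (by fun_prop) continuous_const

theorem continuousAt_of_coordinates {B : Type*} [TopologicalSpace B] {b : B}
    {f : B → ComplexPoints E} {g : B → Fin 3 → ℂ} (hg : ContinuousAt g b)
    (hns : ∀ᶠ x in 𝓝 b, (E.baseChange ℂ).toProjective.Nonsingular (g x))
    (hfg : ∀ᶠ x in 𝓝 b, f x = Projective.Point.toAffine (E.baseChange ℂ) (g x)) :
    ContinuousAt f b := by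
  classical
  let g' : B → Cone E := fun x =>
    if h : (E.baseChange ℂ).toProjective.Nonsingular (g x) then ⟨g x, h⟩
    else ⟨g b, hns.self_of_nhds⟩
  have hg' : ∀ᶠ x in 𝓝 b, (g' x).1 = g x := hns.mono fun x hx => by simp [g', hx]
  have hg'cont : ContinuousAt g' b :=
    IsInducing.subtypeVal.continuousAt_iff.mpr (hg.congr (hg'.mono fun x hx => hx.symm))
  have hcomp : ContinuousAt (fun x => ofCone (g' x)) b :=
    continuous_ofCone.continuousAt.comp hg'cont
  refine hcomp.congr ?_
  filter_upwards [hg', hfg] with x hx hfx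
  rw [hfx, ← hx]
  rfl

theorem continuousAt_of_affine_coordinates {F : ComplexPoints E → ℂ} {G : ℂ × ℂ → ℂ}
    (hG : Continuous G) (hF : ∀ x y h, F (.some x y h) = G (x, y)) {P : ComplexPoints E}
    (hP : P ≠ 0) : ContinuousAt F P := by
  obtain ⟨v, rfl⟩ := ofCone_surjective P
  have hv := (ofCone_ne_zero_iff v).mp hP
  have hcont : ContinuousAt (fun v : Cone E => G (v.1 0 / v.1 2, v.1 1 / v.1 2)) v :=
    hG.continuousAt.comp (by fun_prop (disch := exact hv))
  refine isOpenQuotientMap_ofCone.continuousAt_comp_iff.mp (hcont.congr ?_)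
  filter_upwards [(Cone.continuous_coord 2).continuousAt.eventually_ne hv] with w hw
  rw [Function.comp, ofCone, Projective.Point.toAffine_of_Z_ne_zero w.2 hw, hF]

theorem continuous_neg : Continuous fun P : ComplexPoints E => -P := by
  refine isOpenQuotientMap_ofCone.continuous_comp_iff.mp
    (continuous_iff_continuousAt.mpr fun v => ?_)
  refine continuousAt_of_coordinates (g := fun v : Cone E => (E.baseChange ℂ).toProjective.neg v.1)
    ?_ (.of_forall fun v => Projective.nonsingular_neg v.2)
    (.of_forall fun v => (Projective.Point.toAffine_neg v.2).symm)
  refine Continuous.continuousAt (continuous_pi fun i => ?_)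
  fin_cases i
  · exact Cone.continuous_coord 0
  · change Continuous fun v : Cone E => (E.baseChange ℂ).toProjective.negY v.1
    simp only [Projective.negY]
    fun_prop
  · exact Cone.continuous_coord 2

theorem continuous_addXYZ : Continuous fun v : (Fin 3 → ℂ) × (Fin 3 → ℂ) =>
    (E.baseChange ℂ).toProjective.addXYZ v.1 v.2 := by
  refine continuous_pi fun i => ?_
  fin_cases i
  · simp only [Projective.addXYZ, Projective.addX, Fin.zero_eta, Matrix.cons_val_zero]
    fun_prop
  · simp only [Projective.addXYZ, Projective.addY, Projective.negAddY, Projective.negY,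
      Projective.addX, Projective.addZ, Fin.mk_one, Matrix.cons_val_one, Matrix.cons_val_zero,
      Projective.fin3_def_ext]
    fun_prop
  · simp only [Projective.addXYZ, Projective.addZ, Fin.reduceFinMk, Matrix.cons_val]
    fun_prop

theorem not_equiv_of_addXYZ_ne_zero {x y : Fin 3 → ℂ}
    (h : (E.baseChange ℂ).toProjective.addXYZ x y ≠ 0) : ¬ x ≈ y := by
  rintro ⟨a, rfl⟩
  refine h ?_
  have hsmul := Projective.addXYZ_smul (W' := E.baseChange ℂ) y y (a : ℂ) 1
  rw [one_smul, Projective.addXYZ_self] at hsmul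
  exact hsmul.trans (by simp)

theorem addXYZ_ne_zero {v w : Cone E} (h : ¬ v.1 ≈ w.1) :
    (E.baseChange ℂ).toProjective.addXYZ v.1 w.1 ≠ 0 := by
  rw [← Projective.add_of_not_equiv h]
  exact Cone.ne_zero ⟨_, Projective.nonsingular_add v.2 w.2⟩

theorem continuousAt_add_ofCone {v w : Cone E} (h : ¬ v.1 ≈ w.1) :
    ContinuousAt (fun x : Cone E × Cone E => ofCone x.1 + ofCone x.2) (v, w) := by
  have hc : Continuous fun x : Cone E × Cone E =>
      (E.baseChange ℂ).toProjective.addXYZ x.1.1 x.2.1 :=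
    (continuous_addXYZ (E := E)).comp (f := fun x : Cone E × Cone E => (x.1.1, x.2.1))
      (by fun_prop)
  have hev : ∀ᶠ x in 𝓝 (v, w), ¬ x.1.1 ≈ x.2.1 :=
    (hc.continuousAt.eventually_ne (addXYZ_ne_zero h)).mono fun x => not_equiv_of_addXYZ_ne_zero
  refine continuousAt_of_coordinates hc.continuousAt (hev.mono fun x hx => ?_)
    (hev.mono fun x hx => ?_)
  · rw [← Projective.add_of_not_equiv hx]
    exact Projective.nonsingular_add x.1.2 x.2.2
  · rw [← Projective.add_of_not_equiv hx]
    exact (Projective.Point.toAffine_add x.1.2 x.2.2).symm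

theorem continuousAt_add_of_ne {P Q : ComplexPoints E} (hPQ : P ≠ Q) :
    ContinuousAt (fun x : ComplexPoints E × ComplexPoints E => x.1 + x.2) (P, Q) := by
  obtain ⟨v, rfl⟩ := ofCone_surjective P
  obtain ⟨w, rfl⟩ := ofCone_surjective Q
  have hq := isOpenQuotientMap_ofCone (E := E)
  exact ((hq.prodMap hq).continuousAt_comp_iff
    (g := fun x : ComplexPoints E × ComplexPoints E => x.1 + x.2) (x := (v, w))).mp
    (continuousAt_add_ofCone (mt ofCone_eq_iff.mpr hPQ))

section Coordinates

/-- The function `x` on `E(ℂ)`, with the value `0` at infinity. -/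
noncomputable def xCoord : ComplexPoints E → ℂ
  | .zero => 0
  | .some x _ _ => x

/-- The function `ψ = 2y + a₁x + a₃` on `E(ℂ)`, with the value `0` at infinity. It is used as a
coordinate in place of `y`: the curve becomes `ψ² = 4x³ + b₂x² + 2b₄x + b₆`, negation becomes
`ψ ↦ -ψ`, and the invariant differential is `dx / ψ`. -/
noncomputable def psi : ComplexPoints E → ℂ
  | .zero => 0
  | .some x y _ => 2 * y + (E.baseChange ℂ).a₁ * x + (E.baseChange ℂ).a₃

/-- The cubic polynomial function that expresses `ψ²` in terms of `x`. -/
noncomputable def psiSq (E : WeierstrassCurve ℝ) (x : ℂ) : ℂ :=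
  4 * x ^ 3 + (E.baseChange ℂ).b₂ * x ^ 2 + 2 * (E.baseChange ℂ).b₄ * x + (E.baseChange ℂ).b₆

theorem finite_psiSq_zeros : {x | psiSq E x = 0}.Finite := by
  have h : (E.baseChange ℂ).twoTorsionPolynomial.toPoly ≠ 0 :=
    Cubic.ne_zero_of_a_ne_zero (by simp [twoTorsionPolynomial])
  refine (Polynomial.finite_setOfPred_isRoot h).subset fun x hx => ?_
  simpa [Polynomial.IsRoot, Cubic.toPoly, twoTorsionPolynomial, psiSq] using hx

theorem hasDerivAt_psiSq (x : ℂ) : HasDerivAt (psiSq E)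
    (12 * x ^ 2 + 2 * (E.baseChange ℂ).b₂ * x + 2 * (E.baseChange ℂ).b₄) x := by
  have h := ((((hasDerivAt_pow 3 x).const_mul 4).add
    ((hasDerivAt_pow 2 x).const_mul (E.baseChange ℂ).b₂)).add
    ((hasDerivAt_id x).const_mul (2 * (E.baseChange ℂ).b₄))).add_const (E.baseChange ℂ).b₆
  refine h.congr_deriv ?_
  norm_num
  ring

theorem differentiable_psiSq : Differentiable ℂ (psiSq E) := fun x =>
  (hasDerivAt_psiSq x).differentiableAt

theorem psi_sq {P : ComplexPoints E} (hP : P ≠ 0) : psi P ^ 2 = psiSq E (xCoord P) := by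
  rcases P with _ | ⟨x, y, h⟩
  · exact absurd rfl hP
  · have hxy := (Affine.equation_iff _ _).mp h.1
    rw [psi, psiSq, xCoord, b₂, b₄, b₆]
    linear_combination 4 * hxy

theorem ext_xCoord_psi {P Q : ComplexPoints E} (hP : P ≠ 0) (hQ : Q ≠ 0)
    (hx : xCoord P = xCoord Q) (hpsi : psi P = psi Q) : P = Q := by
  rcases P with _ | ⟨x, y, h⟩
  · exact absurd rfl hP
  rcases Q with _ | ⟨x', y', h'⟩
  · exact absurd rfl hQ
  obtain rfl : x = x' := hx
  obtain rfl : y = y' := by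
    simp only [psi] at hpsi
    linear_combination hpsi / 2
  rfl

theorem xCoord_neg (P : ComplexPoints E) : xCoord (-P) = xCoord P := by
  rcases P with _ | ⟨x, y, h⟩ <;> rfl

theorem psi_neg (P : ComplexPoints E) : psi (-P) = -psi P := by
  rcases P with _ | ⟨x, y, h⟩
  · exact neg_zero.symm
  · change psi (.some x ((E.baseChange ℂ).toAffine.negY x y) _) = _
    rw [psi, psi, Affine.negY]
    ring

theorem eq_or_eq_neg_of_xCoord_eq {P Q : ComplexPoints E} (hP : P ≠ 0) (hQ : Q ≠ 0)
    (hx : xCoord P = xCoord Q) : P = Q ∨ P = -Q := by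
  have hsq : psi P ^ 2 = psi Q ^ 2 := by rw [psi_sq hP, psi_sq hQ, hx]
  exact (sq_eq_sq_iff_eq_or_eq_neg.mp hsq).imp (ext_xCoord_psi hP hQ hx) fun h =>
    ext_xCoord_psi hP (neg_ne_zero.mpr hQ) (hx.trans (xCoord_neg Q).symm)
      (h.trans (psi_neg Q).symm)

theorem xCoord_add {P Q : ComplexPoints E} (hP : P ≠ 0) (hQ : Q ≠ 0) (h : xCoord P ≠ xCoord Q) :
    xCoord (P + Q) = (((psi P - psi Q) / (xCoord P - xCoord Q)) ^ 2 - (E.baseChange ℂ).b₂) / 4 -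
      xCoord P - xCoord Q := by
  rcases P with _ | ⟨x₁, y₁, h₁⟩
  · exact absurd rfl hP
  rcases Q with _ | ⟨x₂, y₂, h₂⟩
  · exact absurd rfl hQ
  have hx : x₁ ≠ x₂ := h
  have hd : x₁ - x₂ ≠ 0 := sub_ne_zero.mpr hx
  rw [Affine.Point.add_of_X_ne hx]
  simp only [xCoord, psi, Affine.slope_of_X_ne hx, Affine.addX, b₂]
  field_simp
  ring

theorem psi_add {P Q : ComplexPoints E} (hP : P ≠ 0) (hQ : Q ≠ 0) (h : xCoord P ≠ xCoord Q) :
    psi (P + Q) =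
      (psi P - psi Q) / (xCoord P - xCoord Q) * (xCoord P - xCoord (P + Q)) - psi P := by
  rcases P with _ | ⟨x₁, y₁, h₁⟩
  · exact absurd rfl hP
  rcases Q with _ | ⟨x₂, y₂, h₂⟩
  · exact absurd rfl hQ
  have hx : x₁ ≠ x₂ := h
  have hd : x₁ - x₂ ≠ 0 := sub_ne_zero.mpr hx
  rw [Affine.Point.add_of_X_ne hx]
  simp only [xCoord, psi, Affine.slope_of_X_ne hx, Affine.addX, Affine.addY, Affine.negAddY,
    Affine.negY]
  field_simp
  ring

theorem continuousAt_xCoord {P : ComplexPoints E} (hP : P ≠ 0) : ContinuousAt xCoord P :=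
  continuousAt_of_affine_coordinates continuous_fst (fun _ _ _ => rfl) hP

theorem continuousAt_psi {P : ComplexPoints E} (hP : P ≠ 0) : ContinuousAt psi P :=
  continuousAt_of_affine_coordinates
    (G := fun v => 2 * v.2 + (E.baseChange ℂ).a₁ * v.1 + (E.baseChange ℂ).a₃) (by fun_prop)
    (fun _ _ _ => rfl) hP

/-- The affine point with `x`-coordinate `x` and `ψ`-coordinate `s`, or `0` if there is none. -/
noncomputable def ofXPsi (E : WeierstrassCurve ℝ) (x s : ℂ) : ComplexPoints E :=
  Projective.Point.toAffine (E.baseChange ℂ)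
    ![x, (s - (E.baseChange ℂ).a₁ * x - (E.baseChange ℂ).a₃) / 2, 1]

variable [E.IsElliptic]

theorem nonsingular_of_sq_eq_psiSq {x s : ℂ} (h : s ^ 2 = psiSq E x) :
    (E.baseChange ℂ).toAffine.Nonsingular x
      ((s - (E.baseChange ℂ).a₁ * x - (E.baseChange ℂ).a₃) / 2) := by
  have : (E.baseChange ℂ).IsElliptic := inferInstanceAs (E.map (algebraMap ℝ ℂ)).IsElliptic
  refine (Affine.equation_iff_nonsingular (W := E.baseChange ℂ)).mp
    ((Affine.equation_iff _ _).mpr ?_)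
  rw [psiSq, b₂, b₄, b₆] at h
  linear_combination h / 4

section

variable {x s : ℂ} (h : s ^ 2 = psiSq E x)
include h

theorem ofXPsi_eq : ofXPsi E x s = .some x _ (nonsingular_of_sq_eq_psiSq h) :=
  Projective.Point.toAffine_some
    ((Projective.nonsingular_some _ _).mpr (nonsingular_of_sq_eq_psiSq h))

theorem ofXPsi_ne_zero : ofXPsi E x s ≠ 0 := by
  rw [ofXPsi_eq h]
  exact Affine.Point.some_ne_zero _

theorem xCoord_ofXPsi : xCoord (ofXPsi E x s) = x := by rw [ofXPsi_eq h, xCoord]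

theorem psi_ofXPsi : psi (ofXPsi E x s) = s := by
  rw [ofXPsi_eq h, psi]
  ring

end

theorem ofXPsi_xCoord_psi {P : ComplexPoints E} (hP : P ≠ 0) : ofXPsi E (xCoord P) (psi P) = P :=
  have h := psi_sq hP
  ext_xCoord_psi (ofXPsi_ne_zero h) hP (xCoord_ofXPsi h) (psi_ofXPsi h)

theorem continuousAt_ofXPsi {B : Type*} [TopologicalSpace B] {f g : B → ℂ} {b : B}
    (hf : ContinuousAt f b) (hg : ContinuousAt g b) (h : ∀ᶠ x in 𝓝 b, g x ^ 2 = psiSq E (f x)) :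
    ContinuousAt (fun x => ofXPsi E (f x) (g x)) b := by
  refine continuousAt_of_coordinates (hfg := .of_forall fun x => rfl) ?_ ?_
  · refine continuousAt_pi.mpr fun i => ?_
    fin_cases i
    · exact hf
    · exact ((hg.sub (continuousAt_const.mul hf)).sub continuousAt_const).div_const 2
    · exact continuousAt_const
  · exact h.mono fun x hx =>
      (Projective.nonsingular_some _ _).mpr (nonsingular_of_sq_eq_psiSq hx)

theorem exists_xCoord_eq (x : ℂ) : ∃ P : ComplexPoints E, P ≠ 0 ∧ xCoord P = x := by
  obtain ⟨s, hs⟩ := IsAlgClosed.exists_pow_nat_eq (psiSq E x) two_pos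
  exact ⟨ofXPsi E x s, ofXPsi_ne_zero hs, xCoord_ofXPsi hs⟩

theorem exists_psi_ne_zero {s : Set ℂ} (hs : s.Finite) :
    ∃ T : ComplexPoints E, T ≠ 0 ∧ xCoord T ∉ s ∧ psi T ≠ 0 := by
  obtain ⟨x, hx⟩ := ((finite_psiSq_zeros (E := E)).union hs).infinite_compl.nonempty
  obtain ⟨T, hT, rfl⟩ := exists_xCoord_eq (E := E) x
  refine ⟨T, hT, fun h => hx (Or.inr h), fun h => hx (Or.inl ?_)⟩
  rw [Set.mem_ofPred_eq, ← psi_sq hT, h, zero_pow two_ne_zero]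

/- On the diagonal, where the addition formulas degenerate, `P + Q = (P + T) + (Q - T)` for a
suitable point `T`. -/
theorem continuousAt_add_self (P : ComplexPoints E) :
    ContinuousAt (fun x : ComplexPoints E × ComplexPoints E => x.1 + x.2) (P, P) := by
  obtain ⟨T, -, hTP, hT⟩ := exists_psi_ne_zero (E := E) (Set.finite_singleton (xCoord P))
  have hPT : P ≠ T := fun h => hTP (congrArg xCoord h.symm)
  have hPnegT : P ≠ -T := fun h => hTP (by rw [h, xCoord_neg]; rfl)
  have hne : P + T ≠ P + -T := fun h => hT (self_eq_neg.mp (by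
    rw [← psi_neg, ← add_left_cancel h]))
  have hadd : ContinuousAt (fun Q => Q + T) P :=
    ContinuousAt.comp (g := fun x : ComplexPoints E × ComplexPoints E => x.1 + x.2)
      (f := fun Q => (Q, T)) (continuousAt_add_of_ne hPT) (by fun_prop)
  have hsub : ContinuousAt (fun Q => Q + -T) P :=
    ContinuousAt.comp (g := fun x : ComplexPoints E × ComplexPoints E => x.1 + x.2)
      (f := fun Q => (Q, -T)) (continuousAt_add_of_ne hPnegT) (by fun_prop)
  have hcomp := ContinuousAt.comp (g := fun x : ComplexPoints E × ComplexPoints E => x.1 + x.2)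
    (f := Prod.map (· + T) (· + -T)) (x := (P, P))
    (continuousAt_add_of_ne hne) (hadd.prodMap hsub)
  refine hcomp.congr (.of_forall fun x => ?_)
  simp only [Function.comp, Prod.map]
  abel

instance : IsTopologicalAddGroup (ComplexPoints E) where
  continuous_add := continuous_iff_continuousAt.mpr fun ⟨P, Q⟩ => by
    rcases eq_or_ne P Q with rfl | hPQ
    · exact continuousAt_add_self P
    · exact continuousAt_add_of_ne hPQ
  continuous_neg := continuous_neg

end Coordinates

/-! ### Uniformization by the logarithm -/

section Logarithm

/-- A branch `s` of `ψ` as a function of `x` on a disc about `x(P₀)`, together with a primitive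
`log` of the invariant differential `dx / ψ` on this disc. -/
structure LocalLog (P₀ : ComplexPoints E) where
  base_ne_zero : P₀ ≠ 0
  r : ℝ
  r_pos : 0 < r
  s : ℂ → ℂ
  log : ℂ → ℂ
  log_base : log (xCoord P₀) = 0
  s_base : s (xCoord P₀) = psi P₀
  s_sq : ∀ x ∈ Metric.ball (xCoord P₀) r, s x ^ 2 = psiSq E x
  differentiableAt_s : ∀ x ∈ Metric.ball (xCoord P₀) r, DifferentiableAt ℂ s x
  s_ne_zero : ∀ x ∈ Metric.ball (xCoord P₀) r, s x ≠ 0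
  hasDerivAt_log : ∀ x ∈ Metric.ball (xCoord P₀) r, HasDerivAt log (s x)⁻¹ x

theorem nonempty_localLog {P₀ : ComplexPoints E} (hP₀ : P₀ ≠ 0) (hpsi : psi P₀ ≠ 0) :
    Nonempty (LocalLog P₀) := by
  obtain ⟨r, hr, s, hs0, hs⟩ := exists_differentiable_sqrt differentiable_psiSq (psi_sq hP₀) hpsi
  have hd : DifferentiableOn ℂ (fun x => (s x)⁻¹) (Metric.ball (xCoord P₀) r) := fun x hx =>
    ((hs x hx).2.1.inv (hs x hx).2.2).differentiableWithinAt
  obtain ⟨log, hlog0, hlog⟩ := hd.isExactOn_ball.with_val_at (xCoord P₀) 0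
  exact ⟨⟨hP₀, r, hr, s, log, hlog0, hs0, fun x hx => (hs x hx).1, fun x hx => (hs x hx).2.1,
    fun x hx => (hs x hx).2.2, hlog⟩⟩

namespace LocalLog

variable {P₀ : ComplexPoints E} (L : LocalLog P₀)

theorem ball_mem_nhds : Metric.ball (xCoord P₀) L.r ∈ 𝓝 (xCoord P₀) :=
  Metric.ball_mem_nhds _ L.r_pos

theorem base_mem_ball : xCoord P₀ ∈ Metric.ball (xCoord P₀) L.r := Metric.mem_ball_self L.r_pos

/-- `P` is an affine point over the disc, on the chosen branch of `ψ`. -/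
def OnBranch (P : ComplexPoints E) : Prop :=
  P ≠ 0 ∧ xCoord P ∈ Metric.ball (xCoord P₀) L.r ∧ psi P = L.s (xCoord P)

theorem onBranch_base : L.OnBranch P₀ := ⟨L.base_ne_zero, L.base_mem_ball, L.s_base.symm⟩

theorem eventually_onBranch : ∀ᶠ P in 𝓝 P₀, L.OnBranch P := by
  have hx := continuousAt_xCoord L.base_ne_zero
  have hs : ContinuousAt (fun P => L.s (xCoord P)) P₀ :=
    ContinuousAt.comp (g := L.s) (L.differentiableAt_s _ L.base_mem_ball).continuousAt hx
  have h0 : psi P₀ + L.s (xCoord P₀) ≠ 0 := by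
    rw [← L.s_base, ← two_mul]
    exact mul_ne_zero two_ne_zero (L.s_ne_zero _ L.base_mem_ball)
  filter_upwards [isClosed_singleton_zero.isOpen_compl.mem_nhds L.base_ne_zero,
    hx.eventually_mem L.ball_mem_nhds,
    ((continuousAt_psi L.base_ne_zero).add hs).eventually_ne h0] with P hP hball hne
  have hsq : psi P ^ 2 = L.s (xCoord P) ^ 2 := by rw [psi_sq hP, L.s_sq _ hball]
  exact ⟨hP, hball, (sq_eq_sq_iff_eq_or_eq_neg.mp hsq).resolve_right fun h =>
    hne (add_eq_zero_iff_eq_neg.mpr h)⟩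

theorem exists_log_localInverse : ∃ M : ℂ → ℂ, Tendsto M (𝓝 0) (𝓝 (xCoord P₀)) ∧
    (∀ᶠ x in 𝓝 (xCoord P₀), M (L.log x) = x) ∧ ∀ᶠ v in 𝓝 0, L.log (M v) = v := by
  have hanalytic : AnalyticAt ℂ L.log (xCoord P₀) := DifferentiableOn.analyticAt
    (fun x hx => (L.hasDerivAt_log x hx).differentiableAt.differentiableWithinAt) L.ball_mem_nhds
  have hderiv : deriv L.log (xCoord P₀) ≠ 0 := by
    rw [(L.hasDerivAt_log _ L.base_mem_ball).deriv]
    exact inv_ne_zero (L.s_ne_zero _ L.base_mem_ball)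
  have hstrict := hanalytic.hasStrictDerivAt.hasStrictFDerivAt_equiv hderiv
  refine ⟨hstrict.localInverse L.log _ (xCoord P₀), ?_, hstrict.eventually_left_inverse, ?_⟩
  · simpa only [L.log_base] using hstrict.localInverse_tendsto
  · simpa only [L.log_base] using hstrict.eventually_right_inverse

end LocalLog

theorem deriv_slope_mul_eq {x₁ x₂ s₁ s₂ s' : ℂ} (hx : x₁ ≠ x₂) (h₁ : s₁ ^ 2 = psiSq E x₁)
    (h₂ : s₂ ^ 2 = psiSq E x₂)
    (hs' : 2 * s₁ * s' = 12 * x₁ ^ 2 + 2 * (E.baseChange ℂ).b₂ * x₁ + 2 * (E.baseChange ℂ).b₄) :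
    (s' * (x₁ - x₂) - (s₁ - s₂)) / (x₁ - x₂) ^ 2 * s₁ =
      2 * (x₁ - ((((s₁ - s₂) / (x₁ - x₂)) ^ 2 - (E.baseChange ℂ).b₂) / 4 - x₁ - x₂)) := by
  have hd : x₁ - x₂ ≠ 0 := sub_ne_zero.mpr hx
  obtain ⟨m, hm⟩ : ∃ m, m = (s₁ - s₂) / (x₁ - x₂) := ⟨_, rfl⟩
  rw [← hm]
  obtain rfl : s₂ = s₁ - m * (x₁ - x₂) := by
    rw [hm, div_mul_cancel₀ _ hd]
    ring
  rw [psiSq] at h₁ h₂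
  have hchord : m * (2 * s₁ - m * (x₁ - x₂)) =
      4 * (x₁ ^ 2 + x₁ * x₂ + x₂ ^ 2) + (E.baseChange ℂ).b₂ * (x₁ + x₂) +
        2 * (E.baseChange ℂ).b₄ :=
    mul_left_cancel₀ hd (by linear_combination h₁ - h₂)
  rw [div_mul_eq_mul_div, div_eq_iff (pow_ne_zero 2 hd)]
  linear_combination (x₁ - x₂) / 2 * (hs' - hchord)

variable [E.IsElliptic]

/- Translation by `S` preserves the invariant differential: along any branch `s` of `ψ`,
`d x(P + S) / ψ(P + S) = dx / ψ`. -/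
theorem hasDerivAt_xCoord_add {s : ℂ → ℂ} {t : ℂ} (hd : DifferentiableAt ℂ s t)
    (hs : ∀ᶠ u in 𝓝 t, s u ^ 2 = psiSq E u) (h0 : s t ≠ 0) {S : ComplexPoints E} (hS : S ≠ 0)
    (ht : t ≠ xCoord S) :
    HasDerivAt (fun u => xCoord (ofXPsi E u (s u) + S)) (psi (ofXPsi E t (s t) + S) / s t) t := by
  have hx {u : ℂ} (hu : s u ^ 2 = psiSq E u) (hne : u ≠ xCoord S) :
      xCoord (ofXPsi E u (s u) + S) =
        (((s u - psi S) / (u - xCoord S)) ^ 2 - (E.baseChange ℂ).b₂) / 4 - u - xCoord S := by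
    rw [xCoord_add (ofXPsi_ne_zero hu) hS (by rwa [xCoord_ofXPsi hu]), xCoord_ofXPsi hu,
      psi_ofXPsi hu]
  have hst := hs.self_of_nhds
  have hs' : 2 * s t * deriv s t =
      12 * t ^ 2 + 2 * (E.baseChange ℂ).b₂ * t + 2 * (E.baseChange ℂ).b₄ := by
    have h := (hd.hasDerivAt.pow 2).unique ((hasDerivAt_psiSq t).congr_of_eventuallyEq hs)
    rwa [Nat.cast_ofNat, Nat.add_one_sub_one, pow_one] at h
  have hslope := (hd.hasDerivAt.sub_const (psi S)).div ((hasDerivAt_id t).sub_const (xCoord S))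
    (sub_ne_zero.mpr ht)
  have hformula := (((((hslope.pow 2).sub_const (E.baseChange ℂ).b₂).div_const 4).sub
    (hasDerivAt_id t)).sub_const (xCoord S)).congr_of_eventuallyEq
      (f₁ := fun u => xCoord (ofXPsi E u (s u) + S))
      (by filter_upwards [hs, isOpen_ne.mem_nhds ht] with u hu hne using hx hu hne)
  refine hformula.congr_deriv ?_
  rw [eq_div_iff h0, psi_add (ofXPsi_ne_zero hst) hS (by rwa [xCoord_ofXPsi hst]), hx hst ht,
    xCoord_ofXPsi hst, psi_ofXPsi hst]
  simp only [Nat.cast_ofNat, id_eq, mul_one, Nat.add_one_sub_one, pow_one, Pi.div_apply]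
  linear_combination (s t - psi S) / (t - xCoord S) / 2 *
    deriv_slope_mul_eq ht hst (psi_sq hS) hs'

namespace LocalLog

variable {P₀ : ComplexPoints E} (L : LocalLog P₀)

/-- The point over `x` on the chosen branch of `ψ`. -/
noncomputable def point (x : ℂ) : ComplexPoints E := ofXPsi E x (L.s x)

theorem point_ne_zero {x : ℂ} (hx : x ∈ Metric.ball (xCoord P₀) L.r) : L.point x ≠ 0 :=
  ofXPsi_ne_zero (L.s_sq x hx)

theorem xCoord_point {x : ℂ} (hx : x ∈ Metric.ball (xCoord P₀) L.r) : xCoord (L.point x) = x :=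
  xCoord_ofXPsi (L.s_sq x hx)

variable {L} in
theorem OnBranch.point_xCoord {P : ComplexPoints E} (h : L.OnBranch P) :
    L.point (xCoord P) = P := by
  rw [point, ← h.2.2, ofXPsi_xCoord_psi h.1]

theorem tendsto_point : Tendsto L.point (𝓝 (xCoord P₀)) (𝓝 P₀) := by
  have hcont : ContinuousAt L.point (xCoord P₀) := continuousAt_ofXPsi continuousAt_id
    (L.differentiableAt_s _ L.base_mem_ball).continuousAt
    (Filter.mem_of_superset L.ball_mem_nhds L.s_sq)
  exact hcont.tendsto.trans_eq (congrArg 𝓝 L.onBranch_base.point_xCoord)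

/- Both sides have the same derivative in `t` and agree at `t = x(P₀)`. -/
theorem log_xCoord_point_add {δ : ℝ} (hδ : δ ≤ L.r) {S : ComplexPoints E}
    (hadd : ∀ t ∈ Metric.ball (xCoord P₀) δ, L.OnBranch (L.point t + S))
    (hne : ∀ t ∈ Metric.ball (xCoord P₀) δ, L.point t ≠ S) {t : ℂ}
    (ht : t ∈ Metric.ball (xCoord P₀) δ) :
    L.log (xCoord (L.point t + S)) = L.log t + L.log (xCoord (P₀ + S)) := by
  have hr {u : ℂ} (hu : u ∈ Metric.ball (xCoord P₀) δ) : u ∈ Metric.ball (xCoord P₀) L.r :=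
    Metric.ball_subset_ball hδ hu
  rcases eq_or_ne S 0 with rfl | hS
  · rw [add_zero, add_zero, L.log_base, add_zero, L.xCoord_point (hr ht)]
  have hxne {u : ℂ} (hu : u ∈ Metric.ball (xCoord P₀) δ) : u ≠ xCoord S := fun h =>
    (eq_or_eq_neg_of_xCoord_eq (L.point_ne_zero (hr hu)) hS
      ((L.xCoord_point (hr hu)).trans h)).elim (hne u hu)
        fun h => (hadd u hu).1 (add_eq_zero_iff_eq_neg.mpr h)
  have hderiv {u : ℂ} (hu : u ∈ Metric.ball (xCoord P₀) δ) :
      HasDerivAt (fun t => L.log (xCoord (L.point t + S)) - L.log t) 0 u := by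
    obtain ⟨-, hball, hpsi⟩ := hadd u hu
    have hx : HasDerivAt (fun t => xCoord (L.point t + S)) (psi (L.point u + S) / L.s u) u :=
      hasDerivAt_xCoord_add (L.differentiableAt_s u (hr hu))
        (Filter.mem_of_superset (Metric.isOpen_ball.mem_nhds (hr hu)) L.s_sq)
        (L.s_ne_zero u (hr hu)) hS (hxne hu)
    refine (((L.hasDerivAt_log _ hball).comp u hx).sub
      (L.hasDerivAt_log u (hr hu))).congr_deriv ?_
    rw [hpsi, ← mul_div_assoc, inv_mul_cancel₀ (L.s_ne_zero _ hball), one_div, sub_self]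
  have hconst := Metric.isOpen_ball.is_const_of_deriv_eq_zero
    (convex_ball (xCoord P₀) δ).isPreconnected
    (fun u hu => (hderiv hu).differentiableAt.differentiableWithinAt)
    (fun u hu => (hderiv hu).deriv) ht (Metric.mem_ball_self (Metric.pos_of_mem_ball ht))
  rw [L.onBranch_base.point_xCoord, L.log_base, sub_zero, sub_eq_iff_eq_add] at hconst
  rw [hconst, add_comm]

theorem exists_log_xCoord_point_add : ∃ δ > 0, ∀ᶠ S in 𝓝 (0 : ComplexPoints E),
    ∀ t ∈ Metric.ball (xCoord P₀) δ,
      L.log (xCoord (L.point t + S)) = L.log t + L.log (xCoord (P₀ + S)) := by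
  have hpoint : Tendsto (fun q : ℂ × ComplexPoints E => L.point q.1) (𝓝 (xCoord P₀) ×ˢ 𝓝 0)
      (𝓝 P₀) := L.tendsto_point.comp tendsto_fst
  have hadd := hpoint.add tendsto_snd
  have hsub := hpoint.sub tendsto_snd
  rw [add_zero] at hadd
  rw [sub_zero] at hsub
  obtain ⟨p, hp, q, hq, hpq⟩ := eventually_prod_iff.mp
    ((hadd.eventually L.eventually_onBranch).and
      (hsub.eventually (isClosed_singleton_zero.isOpen_compl.mem_nhds L.base_ne_zero)))
  obtain ⟨δ, hδ, hball⟩ := Metric.eventually_nhds_iff_ball.mp hp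
  refine ⟨min δ L.r, lt_min hδ L.r_pos, ?_⟩
  filter_upwards [hq] with S hS t ht
  have hgood (u : ℂ) (hu : u ∈ Metric.ball (xCoord P₀) (min δ L.r)) :
      L.OnBranch (L.point u + S) ∧ L.point u - S ≠ 0 :=
    hpq (hball u (Metric.ball_subset_ball (min_le_left _ _) hu)) hS
  exact L.log_xCoord_point_add (min_le_right _ _) (fun u hu => (hgood u hu).1)
    (fun u hu => sub_ne_zero.mp (hgood u hu).2) ht

/-- The logarithm transported to a neighbourhood of `0` by the translation by `P₀`. -/
noncomputable def chart (R : ComplexPoints E) : ℂ := L.log (xCoord (P₀ + R))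

include L in
theorem tendsto_xCoord_base_add :
    Tendsto (fun R => xCoord (P₀ + R)) (𝓝 0) (𝓝 (xCoord P₀)) :=
  (continuousAt_xCoord L.base_ne_zero).tendsto.comp (map_add_left_nhds_zero P₀).le

theorem tendsto_chart : Tendsto L.chart (𝓝 0) (𝓝 0) := by
  have hlog : Tendsto L.log (𝓝 (xCoord P₀)) (𝓝 0) :=
    (L.hasDerivAt_log _ L.base_mem_ball).continuousAt.tendsto.trans_eq (congrArg 𝓝 L.log_base)
  exact hlog.comp L.tendsto_xCoord_base_add

theorem eventually_chart_add : ∀ᶠ x : ComplexPoints E × ComplexPoints E in 𝓝 (0, 0),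
    L.chart (x.1 + x.2) = L.chart x.1 + L.chart x.2 := by
  obtain ⟨δ, hδ, hlog⟩ := L.exists_log_xCoord_point_add
  have hbase : Tendsto (P₀ + ·) (𝓝 0) (𝓝 P₀) := (map_add_left_nhds_zero P₀).le
  rw [nhds_prod_eq]
  filter_upwards [tendsto_fst.eventually (hbase.eventually L.eventually_onBranch),
    tendsto_fst.eventually
      (L.tendsto_xCoord_base_add.eventually (Metric.ball_mem_nhds _ hδ)),
    tendsto_snd.eventually hlog] with x hbranch hball hadd
  have h := hadd _ hball
  rwa [hbranch.point_xCoord, add_assoc] at h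

theorem exists_chart_localInverse : ∃ e : ℂ → ComplexPoints E, Tendsto e (𝓝 0) (𝓝 0) ∧
    (∀ᶠ v in 𝓝 0, L.chart (e v) = v) ∧ ∀ᶠ R in 𝓝 0, e (L.chart R) = R := by
  obtain ⟨M, hM, hMlog, hlogM⟩ := L.exists_log_localInverse
  refine ⟨fun v => L.point (M v) - P₀, ?_, ?_, ?_⟩
  · simpa only [sub_self, Function.comp] using (L.tendsto_point.comp hM).sub_const P₀
  · filter_upwards [hlogM, hM.eventually L.ball_mem_nhds] with v hv hball
    rw [chart, add_sub_cancel, L.xCoord_point hball, hv]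
  · filter_upwards [L.tendsto_xCoord_base_add.eventually hMlog,
      (map_add_left_nhds_zero P₀).le L.eventually_onBranch] with R hR hbranch
    rw [chart, hR, hbranch.point_xCoord, add_sub_cancel_left]

end LocalLog

variable (E) in
theorem exists_isOpenMap_isDiscrete_ker : ∃ p : ℂ →ₜ+ ComplexPoints E,
    IsOpenMap p ∧ IsDiscrete (p.toAddMonoidHom.ker : Set ℂ) := by
  obtain ⟨P₀, hP₀, -, hpsi⟩ := exists_psi_ne_zero (E := E) Set.finite_empty
  obtain ⟨L⟩ := nonempty_localLog hP₀ hpsi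
  obtain ⟨e, he, hchart, he'⟩ := L.exists_chart_localInverse
  exact exists_isOpenMap_isDiscrete_ker_of_local_log L.eventually_chart_add he L.tendsto_chart
    hchart he'

end Logarithm

variable [E.IsElliptic]

theorem image_xCoord_mem_nhds {U : Set (ComplexPoints E)} {P : ComplexPoints E} (hP : P ≠ 0)
    (hU : U ∈ 𝓝 P) : xCoord '' U ∈ 𝓝 (xCoord P) := by
  obtain ⟨s, hsP, hscont, hs⟩ :=
    exists_sqrt_continuousAt differentiable_psiSq.continuous.continuousAt (psi_sq hP)
  have hcont := continuousAt_ofXPsi continuousAt_id hscont (.of_forall hs)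
  rw [ContinuousAt, id, hsP, ofXPsi_xCoord_psi hP] at hcont
  filter_upwards [hcont.eventually_mem hU] with x hx
  exact ⟨_, hx, xCoord_ofXPsi (hs x)⟩

theorem isOpen_image_xCoord {U : Set (ComplexPoints E)} (hU : IsOpen U) (h0 : 0 ∉ U) :
    IsOpen (xCoord '' U) := by
  refine isOpen_iff_mem_nhds.mpr ?_
  rintro _ ⟨P, hP, rfl⟩
  exact image_xCoord_mem_nhds (ne_of_mem_of_not_mem hP h0) (hU.mem_nhds hP)

/- The images of `H \ {0}` and of the complement of `H` under `x` are open and cover the connected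
space `ℂ`; they are disjoint because `x` determines a point up to sign. -/
theorem eq_top_of_isOpen {H : AddSubgroup (ComplexPoints E)}
    (hH : IsOpen (H : Set (ComplexPoints E))) (hne : H ≠ ⊥) : H = ⊤ := by
  by_contra htop
  obtain ⟨P, hP, hP0⟩ := H.bot_or_exists_ne_zero.resolve_left hne
  obtain ⟨Q, hQ⟩ := not_forall.mp (mt (AddSubgroup.eq_top_iff' H).mpr htop)
  obtain ⟨_, -, ⟨R, ⟨hR, hR0⟩, rfl⟩, ⟨S, hS, hSx⟩⟩ := isPreconnected_univ (α := ℂ) _ _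
    (isOpen_image_xCoord (hH.sdiff isClosed_singleton_zero) fun h => h.2 rfl)
    (isOpen_image_xCoord (H.isClosed_of_isOpen hH).isOpen_compl fun h => h H.zero_mem)
    (fun x _ => by
      obtain ⟨T, hT, rfl⟩ := exists_xCoord_eq (E := E) x
      by_cases h : T ∈ H
      · exact Or.inl ⟨T, ⟨h, hT⟩, rfl⟩
      · exact Or.inr ⟨T, h, rfl⟩)
    ⟨xCoord P, trivial, P, ⟨hP, hP0⟩, rfl⟩ ⟨xCoord Q, trivial, Q, hQ, rfl⟩
  have hS0 : S ≠ 0 := fun h => hS (h ▸ H.zero_mem)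
  rcases eq_or_eq_neg_of_xCoord_eq hS0 hR0 hSx with rfl | rfl
  · exact hS hR
  · exact hS (H.neg_mem hR)

variable (E) in
theorem exists_uniformization :
    ∃ p : ℂ →ₜ+ ComplexPoints E, IsCoveringMap p ∧ Function.Surjective p := by
  obtain ⟨p, ho, hd⟩ := exists_isOpenMap_isDiscrete_ker E
  have hrange : p.toAddMonoidHom.range = ⊤ := by
    refine eq_top_of_isOpen ho.isOpen_range fun h => ?_
    have hker : p.toAddMonoidHom.ker = ⊤ :=
      AddMonoidHom.ker_eq_top_iff.mpr (AddMonoidHom.range_eq_bot_iff.mp h)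
    rw [hker, AddSubgroup.coe_top, isDiscrete_univ_iff] at hd
    exact not_isOpen_singleton (0 : ℂ) (isOpen_discrete _)
  have hsurj : Function.Surjective p := AddMonoidHom.range_eq_top.mp hrange
  exact ⟨p, isCoveringMap_of_isOpenMap_of_isDiscrete_ker ho hsurj hd, hsurj⟩

end ComplexPoints

/-- For an elliptic curve `E` over `ℝ`, the map on first homology induced by the inclusion
`E(ℂ)⁻₀ ⊆ E(ℂ)` takes values in `H₁(E(ℂ), ℤ)⁻` and is an isomorphism onto it. -/
theorem mainTheorem3 (E : WeierstrassCurve ℝ) [E.IsElliptic] :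
    ∃ ψ : H1 (AntiInvariantComponent E) ≃+ H1minus E,
      ∀ c : H1 (AntiInvariantComponent E),
        (ψ c : H1 (ComplexPoints E)) = H1map (antiInvariantComponentInclusion E) c := by
  obtain ⟨p, hp, hsurj⟩ := ComplexPoints.exists_uniformization E
  let conj : ComplexPoints E →ₜ+ ComplexPoints E := ⟨complexConj E, continuous_complexConj E⟩
  obtain ⟨T, hT⟩ := exists_continuousLinearMap_lift p hp conj
  have hT' (v : ℂ) : (conj + .id _) (p v) = p ((T + .id ℝ ℂ) v) :=
    (congrArg (· + p v) (hT v)).trans (map_add p _ _).symm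
  have hS (P : ComplexPoints E) : P ∈ antiInvariantPoints E ↔ (conj + .id _) P = 0 :=
    eq_neg_iff_add_eq_zero
  have hd := isDiscrete_ker_of_isCoveringMap hp
  have hinj : Function.Injective (H1map (antiInvariantComponentInclusion E)) :=
    H1map_componentInclusion_injective hT' hS hp hd hsurj
  have hrange : (H1map (antiInvariantComponentInclusion E)).range = H1minus E :=
    AddSubgroup.ext fun c => (mem_range_H1map_componentInclusion_iff hT' hS hp hd hsurj c).trans
      (H1map_eq_neg_iff hp hsurj hT c).symm
  exact ⟨(AddMonoidHom.ofInjective hinj).trans (AddEquiv.addSubgroupCongr hrange), fun _ => rfl⟩
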